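/- **Setting.** Let $n,m,k,N\ge 1$. Let $A\in\mathbb R^{n\times m}$ be a matrix with unit-length columns $A_1,\dots,A_m$. It is $(k,\delta)$-RIP if $(1-\delta)\|x\|_2\le\|Ax\|_2\le(1+\delta)\|x\|_2$ for all $x\in\mathbb R^m$ with at most $k$ nonzero entries. Given sets $S_1,\dots,S_N\subseteq[m]$ of size at most $k$ (arbitrary, not random), the samples are $y^{(r)}=Ax^{(r)}$, $r\in[N]$, where $x^{(r)}$ has support $S_r$ and all the values $x^{(r)}_i$ ($r\in[N]$, $i\in S_r$) are independent and uniform on $\{1,-1\}$. **The test** $\textsc{TestCol\_Rad}(z,Y=\{y^{(1)},\dots,y^{(N)}\},\kappa,\kappa',\eta)$. Let $\widetilde\kappa_1$ be the fraction of samples with $|\langle z,y^{(r)}\rangle|\in[1-\eta,1+\eta]$, and $\widetilde\kappa_0$ the fraction with $|\langle z,y^{(r)}\rangle|\notin[1-\eta,1+\eta]\cup[0,\tfrac1{32}\eta]$. If $\widetilde\kappa_0<\kappa$, $\widetilde\kappa_1\ge\kappa'$, and the mean of the samples with $\langle y^{(r)},z\rangle\in(1-10\eta,1+10\eta)$ has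 norm at most $1.1$, output $(\mathrm{YES},\widehat z)$, where $z'$ is the mean of the samples with $\langle y^{(r)},z\rangle\ge\tfrac12$ and $\widehat z=z'/\|z'\|_2$. Otherwise output $\mathrm{NO}$. (The mean of no vectors is $0$, and $0/0=0$.) **Theorem.** The test runs in time $O(N)$: a single program, independent of $n$, $N$ and the input, computes its output using at most $CN$ steps for an absolute constant $C$, where an arithmetic operation or comparison of real numbers, an inner product, norm, sum or scalar multiple of vectors of $\mathbb R^n$, and an access to a sample each count as one step. Moreover, there exist absolute constants $c_1,c_2,c_3,c_4,c_5>0$ such that the following holds. Let $\gamma\in(0,\tfrac12]$, $q_0>0$ and $0<\eta_0<\eta<1$ satisfy $$\sqrt{\frac{c_3k}{m}}<\eta<\frac{c_1}{\log^2\!\big(\frac{mn}{q_0\eta_0}\big)},$$ and set $\kappa_0:=c_4\eta q_0/(km)$. Suppose that - $N\ge\dfrac{c_2\,knm\log(1/\gamma)}{\eta_0^3\kappa_0}$; - $A$ is $(k,\delta)$-RIP for some $\delta<\Big(\dfrac{\eta}{16\log(1/\kappa_0)}\Big)^2$; - for all $i_1,i_2,i_3\in[m]$, at least $q_0N$ of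 the sets $S_r$ contain all of $i_1,i_2,i_3$. Let $z\in\mathbb R^n$ be a (fixed) unit vector. Then with probability at least $1-\gamma$ both of the following hold for $\textsc{TestCol\_Rad}(z,\{y^{(1)},\dots,y^{(N)}\},2\kappa_0,c_5\eta q_0,\eta)$: - (Completeness) if $\|z-bA_i\|_2\le\eta/(8\log(1/\kappa_0))$ for some $i\in[m]$, $b\in\{-1,1\}$, then the test answers YES; - (Soundness) if the test answers $(\mathrm{YES},\widehat z)$, then there exist $i\in[m]$, $b\in\{-1,1\}$ with $\|z-bA_i\|_2\le\sqrt{8\eta}$, $\|\widehat z-bA_i\|_2\le\eta_0$ and $\|z'-bA_i\|_2\le\eta_0$. -/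

import Mathlib

open MeasureTheory ProbabilityTheory

namespace DictTest

/-- `ℝⁿ` with its Euclidean norm and inner product. -/
abbrev Vec (n : ℕ) : Type := EuclideanSpace ℝ (Fin n)

/-! ### Dictionaries -/

/-- The product `A x = ∑ i, x i • A i` of the `n × m` dictionary with columns `A 0, …, A (m - 1)`
and a coefficient vector `x`. -/
noncomputable def synth {n m : ℕ} (A : Fin m → Vec n) (x : Vec m) : Vec n :=
  ∑ i, x i • A i

/-- `(k, δ)`-restricted isometry property: `(1 - δ) ‖x‖ ≤ ‖A x‖ ≤ (1 + δ) ‖x‖` for every vector `x`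
with at most `k` nonzero coordinates. -/
def IsRIP {n m : ℕ} (A : Fin m → Vec n) (k : ℕ) (δ : ℝ) : Prop :=
  ∀ x : Vec m, {i | x i ≠ 0}.ncard ≤ k →
    (1 - δ) * ‖x‖ ≤ ‖synth A x‖ ∧ ‖synth A x‖ ≤ (1 + δ) * ‖x‖

/-! ### Random coefficient vectors with prescribed supports -/

/-- `x r` (for `r : Fin N`) are random coefficient vectors in `ℝᵐ`; the support of `x r` is the
prescribed set `S r`, and the values on the supports are independent (over all coordinates of all
samples) and uniform on `{1, -1}`. -/
structure IsRademacherOn {Ω : Type*} [MeasurableSpace Ω] (P : Measure Ω) {N m : ℕ}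
    (S : Fin N → Finset (Fin m)) (x : Fin N → Ω → Vec m) : Prop where
  measurable : ∀ r i, Measurable fun ω => x r ω i
  eq_zero : ∀ r, ∀ i ∉ S r, ∀ ω, x r ω i = 0
  prob_one : ∀ r, ∀ i ∈ S r, P.real {ω | x r ω i = 1} = 1 / 2
  prob_neg_one : ∀ r, ∀ i ∈ S r, P.real {ω | x r ω i = -1} = 1 / 2
  indep : iIndepFun (fun (p : Fin N × Fin m) ω => x p.1 ω p.2) P

/-! ### The test -/

open Classical in
/-- The fraction of the `N` samples whose index satisfies `p`. -/
noncomputable def fraction {N : ℕ} (p : Fin N → Prop) : ℝ :=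
  ((Finset.univ.filter p).card : ℝ) / N

open Classical in
/-- The mean of the samples whose index satisfies `p` (the mean of no vectors is `0`). -/
noncomputable def meanOf {n N : ℕ} (Y : Fin N → Vec n) (p : Fin N → Prop) : Vec n :=
  ((Finset.univ.filter p).card : ℝ)⁻¹ • ∑ r ∈ Finset.univ.filter p, Y r

/-- The mean `z'` of the samples `y` with `⟨y, z⟩ ≥ 1/2`. -/
noncomputable def halfMean {n N : ℕ} (z : Vec n) (Y : Fin N → Vec n) : Vec n :=
  meanOf Y fun r => 1 / 2 ≤ inner ℝ (Y r) z

open Classical in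
/-- The test `TestCol_Rad(z, Y, κ₀, κ₁, η)`. The value `some v` stands for the answer `(YES, v)` and
`none` for the answer `NO`. -/
noncomputable def testColRad {n N : ℕ} (z : Vec n) (Y : Fin N → Vec n) (κ₀ κ₁ η : ℝ) :
    Option (Vec n) :=
  if fraction (fun r => |inner ℝ z (Y r)| ∉ Set.Icc (1 - η) (1 + η) ∪ Set.Icc 0 (η / 32)) < κ₀ ∧
      κ₁ ≤ fraction (fun r => |inner ℝ z (Y r)| ∈ Set.Icc (1 - η) (1 + η)) ∧
      ‖meanOf Y (fun r => inner ℝ (Y r) z ∈ Set.Ioo (1 - 10 * η) (1 + 10 * η))‖ ≤ 1.1 then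
    some (‖halfMean z Y‖⁻¹ • halfMean z Y)
  else
    none

/-! ### A machine model for the running time

The machine has registers for real numbers and registers for vectors of `ℝⁿ`. Each arithmetic
operation on reals, each of the four vector operations below, each comparison of two reals and each
access to a sample takes one step. -/

/-- The contents of the registers. -/
structure Mem (n : ℕ) where
  num : ℕ → ℝ
  vec : ℕ → Vec n

/-- The elementary instructions; the first argument is the register that receives the result. -/
inductive Instr
  | const (d : ℕ) (q : ℚ)
  | add (d a b : ℕ)
  | sub (d a b : ℕ)
  | mul (d a b : ℕ)
  | div (d a b : ℕ)
  | abs (d a : ℕ)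
  | inner (d a b : ℕ)
  | norm (d a : ℕ)
  | vadd (d a b : ℕ)
  | smul (d a b : ℕ)

/-- The effect of an elementary instruction. -/
noncomputable def Instr.exec {n : ℕ} (s : Mem n) : Instr → Mem n
  | .const d q => { s with num := Function.update s.num d (q : ℝ) }
  | .add d a b => { s with num := Function.update s.num d (s.num a + s.num b) }
  | .sub d a b => { s with num := Function.update s.num d (s.num a - s.num b) }
  | .mul d a b => { s with num := Function.update s.num d (s.num a * s.num b) }
  | .div d a b => { s with num := Function.update s.num d (s.num a / s.num b) }
  | .abs d a => { s with num := Function.update s.num d |s.num a| }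
  | .inner d a b => { s with num := Function.update s.num d (Inner.inner ℝ (s.vec a) (s.vec b)) }
  | .norm d a => { s with num := Function.update s.num d ‖s.vec a‖ }
  | .vadd d a b => { s with vec := Function.update s.vec d (s.vec a + s.vec b) }
  | .smul d a b => { s with vec := Function.update s.vec d (s.num a • s.vec b) }

/-- Programs: `ite a b p q` runs `p` if real register `a` is at most real register `b`, and `q`
otherwise; `forEach p` runs `p` once for every sample, with the sample loaded into vector register
`0`. A program mentions neither the dimension nor the number of samples. -/
inductive Prog
  | skip
  | op (i : Instr)
  | seq (p q : Prog)
  | ite (a b : ℕ) (p q : Prog)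
  | forEach (p : Prog)

open Classical in
/-- The final register contents and the number of steps of a run on the samples `Y`. -/
noncomputable def Prog.run {n N : ℕ} (Y : Fin N → Vec n) : Prog → Mem n → Mem n × ℕ
  | .skip, s => (s, 0)
  | .op i, s => (i.exec s, 1)
  | .seq p q, s =>
      let u := p.run Y s
      let v := q.run Y u.1
      (v.1, u.2 + v.2)
  | .ite a b p q, s =>
      let u := if s.num a ≤ s.num b then p.run Y s else q.run Y s
      (u.1, u.2 + 1)
  | .forEach p, s =>
      (List.finRange N).foldl
        (fun t r =>
          let u := p.run Y { t.1 with vec := Function.update t.1.vec 0 (Y r) }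
          (u.1, t.2 + u.2 + 1))
        (s, 0)

/-- The initial registers: `z` in vector register `1` and `κ₀`, `κ₁`, `η` in real registers `1`, `2`,
`3`; all other registers hold `0`. -/
noncomputable def Mem.input {n : ℕ} (z : Vec n) (κ₀ κ₁ η : ℝ) : Mem n where
  num := fun j => if j = 1 then κ₀ else if j = 2 then κ₁ else if j = 3 then η else 0
  vec := fun j => if j = 1 then z else 0

open Classical in
/-- The answer read off the final registers: `(YES, v)` if real register `0` holds `1`, where `v` is
the content of vector register `0`, and `NO` otherwise. -/
noncomputable def Mem.output {n : ℕ} (s : Mem n) : Option (Vec n) :=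
  if s.num 0 = 1 then some (s.vec 0) else none

end DictTest

open DictTest

/-! Put `w j = ⟨z, A j⟩`. The correlation of `z` with a sample is a random signed sum of the `w j`
over the support, and the test asks whether these sums look as they would for a column: almost
always near `0` or near `±1`. The main tools are the invariance of the law of a sample under sign
flips and the Chernoff and Hoeffding bounds.

Recovery of a column: if `z` is near `b • A i`, the restricted isometry property bounds the energy
of the other correlations on each support (`IsRIP.sum_inner_sq_le_of_near`), so by Hoeffding the
other columns rarely matter and the correlation reads off the coordinate `i`. The selected samples
are then, up to few exceptions, those with coordinate `b` at `i`. Their other coordinates average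
out (`MeanGood`), so their mean is near `b • A i` (`norm_meanOf_sub_le`). This gives completeness,
and also soundness when some `|w i| ≥ 1 - η`.

Soundness when every `|w i| < 1 - η`: call a sum bad if it avoids both the center and the windows
around `±1`. If the expected number of bad sums is at least `4 κ₀ N`, the first condition of the
test fails. Otherwise bad sums are so rare that no family of at most `8 m` flips can carry every
sign vector, on all supports containing up to three given columns, to a bad one
(`not_forall_exists_isBad`). Flipping the coordinate `i` shifts the sum by `2 |w i|`, so each `|w
i|` is near `0` or near `1/2`. Flipping the small coordinates one after another moves their total to
its negative in steps of at most `2 η`, hence past every level in between (`exists_pathFlip`). It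
remains to count the halves. With none, a sum near `±1` could be led into the gap, so few samples
meet the second condition. With exactly one, the small terms can be made to cancel, leaving a bad
sum near `±1/2`: impossible. With two, the window around `1` selects the samples in which both
coordinates contribute positively, and their mean is near `± A i ± A j`, of length about `√2`, which
violates the third condition. With three or more, aligned signs give a sum of about `3/2` or more:
impossible.

For the running time, one pass over the samples maintains four counters, the number of samples and
two vector sums. -/

namespace DictTest

/-! ### Sign flips -/

/-- Negate the coordinates in `J`. -/
def flip {m : ℕ} (J : Finset (Fin m)) (v : Fin m → ℝ) : Fin m → ℝ :=
  fun i => if i ∈ J then -v i else v i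

/-- `v` takes values `±1` on `S` and vanishes off `S`. -/
def IsSignOn {m : ℕ} (S : Finset (Fin m)) (v : Fin m → ℝ) : Prop :=
  (∀ i ∈ S, v i = 1 ∨ v i = -1) ∧ ∀ i ∉ S, v i = 0

lemma IsSignOn.flip {m : ℕ} {S : Finset (Fin m)} {v : Fin m → ℝ} (hv : IsSignOn S v)
    (J : Finset (Fin m)) : IsSignOn S (flip J v) := by
  refine ⟨fun i hi => ?_, fun i hi => ?_⟩
  · rcases hv.1 i hi with h | h <;> by_cases hJ : i ∈ J <;> simp [DictTest.flip, h, hJ]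
  · simp [DictTest.flip, hv.2 i hi]

lemma IsSignOn.abs_le_one {m : ℕ} {S : Finset (Fin m)} {v : Fin m → ℝ} (hv : IsSignOn S v)
    (i : Fin m) : |v i| ≤ 1 := by
  by_cases hi : i ∈ S
  · rcases hv.1 i hi with h | h <;> simp [h]
  · simp [hv.2 i hi]

lemma measurable_flip {m : ℕ} (J : Finset (Fin m)) : Measurable (flip J) := by
  refine measurable_pi_lambda _ fun i => ?_
  by_cases hJ : i ∈ J <;> simp only [flip, hJ, if_true, if_false] <;> fun_prop

/-! ### Symmetry and concentration within one sample -/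

namespace IsRademacherOn

variable {Ω : Type*} [MeasurableSpace Ω] {P : Measure Ω} {N m : ℕ}
  {S : Fin N → Finset (Fin m)} {x : Fin N → Ω → Vec m}

lemma measurable_coeff (h : IsRademacherOn P S x) (r : Fin N) :
    Measurable fun ω i => x r ω i :=
  measurable_pi_lambda _ fun i => h.measurable r i

lemma isProbabilityMeasure (h : IsRademacherOn P S x) : IsProbabilityMeasure P :=
  h.indep.isProbabilityMeasure

lemma ae_isSignOn (h : IsRademacherOn P S x) (r : Fin N) :
    ∀ᵐ ω ∂P, IsSignOn (S r) (fun i => x r ω i) := by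
  have := h.isProbabilityMeasure
  have key : ∀ i, ∀ᵐ ω ∂P, i ∈ S r → (x r ω i = 1 ∨ x r ω i = -1) := by
    intro i
    by_cases hi : i ∈ S r
    · have h1 : MeasurableSet {ω | x r ω i = 1} := h.measurable r i (measurableSet_singleton 1)
      have h2 : MeasurableSet {ω | x r ω i = -1} :=
        h.measurable r i (measurableSet_singleton (-1))
      have hd : Disjoint {ω | x r ω i = 1} {ω | x r ω i = -1} := by
        rw [Set.disjoint_left]
        intro ω ha hb
        simp only [Set.mem_ofPred_eq] at ha hb
        linarith
      have hu : P.real ({ω | x r ω i = 1} ∪ {ω | x r ω i = -1}) = 1 := by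
        rw [measureReal_union hd h2, h.prob_one r i hi, h.prob_neg_one r i hi]; norm_num
      have := (mem_ae_iff_prob_eq_one (h1.union h2)).2 (by
        rw [measureReal_def, ENNReal.toReal_eq_one_iff] at hu; exact hu)
      filter_upwards [this] with ω hω _ using hω
    · simp [hi]
  filter_upwards [ae_all_iff.2 key] with ω hω
  exact ⟨fun i hi => hω i hi, fun i hi => h.eq_zero r i hi ω⟩

/-- Independence of all coordinates says that the joint law over pairs `(r, i)` is a product;
currying makes it a product over `r` of row laws. Whole samples are thus independent, as the
concentration bounds over the samples require. -/
lemma iIndepFun_coeff (h : IsRademacherOn P S x) :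
    iIndepFun (fun r ω i => x r ω i) P := by
  have := h.isProbabilityMeasure
  have hp : ∀ (r : Fin N) (i : Fin m), IsProbabilityMeasure (P.map fun ω => x r ω i) :=
    fun r i => Measure.isProbabilityMeasure_map (h.measurable r i).aemeasurable
  rw [iIndepFun_iff_map_fun_eq_infinitePi_map (fun r => h.measurable_coeff r)]
  have h1 := h.indep.map_fun_eq_infinitePi_map (fun p : Fin N × Fin m => h.measurable p.1 p.2)
  have h2 := Measure.infinitePi_map_curry (X := ℝ) fun (r : Fin N) (i : Fin m) =>
    P.map fun ω => x r ω i
  have hm : Measurable fun ω (p : Fin N × Fin m) => x p.1 ω p.2 :=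
    measurable_pi_lambda _ fun p => h.measurable p.1 p.2
  have hrow : ∀ r, P.map (fun ω i => x r ω i) =
      Measure.infinitePi fun i => P.map fun ω => x r ω i := fun r =>
    (h.indep.precomp (g := fun i => (r, i)) (fun a b hab => by simpa using hab)
      ).map_fun_eq_infinitePi_map (fun i => h.measurable r i)
  simp_rw [hrow]
  rw [← h2, ← h1, Measure.map_map (MeasurableEquiv.measurable _) hm]
  rfl

lemma map_neg_apply (h : IsRademacherOn P S x) (r : Fin N) (i : Fin m) :
    (P.map fun ω => x r ω i).map (fun t => -t) = P.map fun ω => x r ω i := by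
  have := h.isProbabilityMeasure
  have hm := h.measurable r i
  by_cases hi : i ∈ S r
  · have hprob : IsProbabilityMeasure (P.map fun ω => x r ω i) :=
      Measure.isProbabilityMeasure_map hm.aemeasurable
    set μ : Measure ℝ := P.map fun ω => x r ω i with hμ
    have e1 : μ {1} = 1 / 2 := by
      rw [hμ, Measure.map_apply hm (measurableSet_singleton _)]
      have := h.prob_one r i hi
      rw [measureReal_def] at this
      rw [← ENNReal.toReal_eq_toReal_iff' (measure_ne_top _ _) (by simp)]
      simpa [Set.preimage] using this
    have e2 : μ {-1} = 1 / 2 := by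
      rw [hμ, Measure.map_apply hm (measurableSet_singleton _)]
      have := h.prob_neg_one r i hi
      rw [measureReal_def] at this
      rw [← ENNReal.toReal_eq_toReal_iff' (measure_ne_top _ _) (by simp)]
      simpa [Set.preimage] using this
    have hae : ∀ᵐ t ∂μ, t = 1 ∨ t = -1 := by
      refine (ae_map_iff hm.aemeasurable
        ((measurableSet_singleton (1 : ℝ)).union (measurableSet_singleton (-1)))).2 ?_
      filter_upwards [h.ae_isSignOn r] with ω hω using hω.1 i hi
    have hdecomp : μ = (1 / 2 : ENNReal) • Measure.dirac 1 + (1 / 2 : ENNReal) • Measure.dirac (-1) := by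
      have hr : μ = μ.restrict ({1} ∪ {-1}) := by
        rw [Measure.restrict_eq_self_of_ae_mem]
        filter_upwards [hae] with t ht using ht
      rw [hr, Measure.restrict_union (by norm_num [eq_comm]) (measurableSet_singleton _),
        Measure.restrict_singleton, Measure.restrict_singleton, e1, e2]
    have hneg : Measurable fun t : ℝ => -t := measurable_neg
    rw [hdecomp, Measure.map_add _ _ hneg, Measure.map_smul, Measure.map_smul,
      Measure.map_dirac' hneg, Measure.map_dirac' hneg, neg_neg, add_comm]
  · have : (fun ω => x r ω i) = fun _ => (0 : ℝ) := funext fun ω => h.eq_zero r i hi ω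
    have hneg : Measurable fun t : ℝ => -t := measurable_neg
    rw [this, Measure.map_const, Measure.map_smul, Measure.map_dirac' hneg, neg_zero]

/-- The law of a coefficient vector is invariant under sign flips. -/
lemma measurePreserving_flip (h : IsRademacherOn P S x) (r : Fin N) (J : Finset (Fin m)) :
    MeasurePreserving (flip J) (P.map fun ω i => x r ω i) (P.map fun ω i => x r ω i) := by
  have := h.isProbabilityMeasure
  have hp : ∀ i : Fin m, IsProbabilityMeasure (P.map fun ω => x r ω i) :=
    fun i => Measure.isProbabilityMeasure_map (h.measurable r i).aemeasurable
  have hrow : P.map (fun ω i => x r ω i) = Measure.pi fun i => P.map fun ω => x r ω i :=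
    (h.indep.precomp (g := fun i => (r, i)) (fun a b hab => by simpa using hab)
      ).map_fun_eq_pi_map (fun i => (h.measurable r i).aemeasurable)
  rw [hrow]
  have hf : ∀ i : Fin m, MeasurePreserving (fun t : ℝ => if i ∈ J then -t else t)
      (P.map fun ω => x r ω i) (P.map fun ω => x r ω i) := by
    intro i
    by_cases hJ : i ∈ J
    · simpa [hJ] using ⟨measurable_neg, h.map_neg_apply r i⟩
    · simp only [hJ, if_false]
      exact MeasurePreserving.id _
  exact measurePreserving_pi _ _ hf

lemma measureReal_flip (h : IsRademacherOn P S x) (r : Fin N) (J : Finset (Fin m))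
    {B : Set (Fin m → ℝ)} (hB : MeasurableSet B) :
    P.real {ω | flip J (fun i => x r ω i) ∈ B} = P.real {ω | (fun i => x r ω i) ∈ B} := by
  have h1 := (h.measurePreserving_flip r J).measureReal_preimage hB.nullMeasurableSet
  rw [map_measureReal_apply (h.measurable_coeff r) (measurable_flip J hB),
    map_measureReal_apply (h.measurable_coeff r) hB] at h1
  exact h1

/-- If every sign vector in `E` is carried into `B` by one of the flips in `F`, then `E` is at most
`#F` times as likely as `B`. -/
lemma measureReal_le_card_mul (h : IsRademacherOn P S x) (r : Fin N)
    (F : Finset (Finset (Fin m))) (E : Set (Fin m → ℝ)) {B : Set (Fin m → ℝ)}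
    (hB : MeasurableSet B)
    (hE : ∀ v, IsSignOn (S r) v → v ∈ E → ∃ J ∈ F, flip J v ∈ B) :
    P.real {ω | (fun i => x r ω i) ∈ E} ≤ F.card * P.real {ω | (fun i => x r ω i) ∈ B} := by
  have := h.isProbabilityMeasure
  -- Almost surely, `E` is covered by the preimages of `B` under the flips in `F`, each as likely as
  -- `B`. Monotonicity and subadditivity suffice, so `E` need not be measurable.
  calc P.real {ω | (fun i => x r ω i) ∈ E}
      ≤ P.real (⋃ J ∈ F, {ω | flip J (fun i => x r ω i) ∈ B}) := by
        refine ENNReal.toReal_mono (measure_ne_top _ _) (measure_mono_ae ?_)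
        filter_upwards [h.ae_isSignOn r] with ω hω hωE
        obtain ⟨J, hJ, hJB⟩ := hE _ hω hωE
        exact Set.mem_biUnion (show J ∈ (F : Set _) from hJ) hJB
    _ ≤ ∑ J ∈ F, P.real {ω | flip J (fun i => x r ω i) ∈ B} := measureReal_biUnion_finset_le _ _
    _ = F.card * P.real {ω | (fun i => x r ω i) ∈ B} := by
        simp [h.measureReal_flip r _ hB]

/-- A bounded function that is odd under a flip has mean zero. -/
lemma integral_eq_zero_of_flip_eq_neg (h : IsRademacherOn P S x) (r : Fin N)
    (J : Finset (Fin m)) {f : (Fin m → ℝ) → ℝ} (hf : Measurable f)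
    (hodd : ∀ v, f (flip J v) = -f v) : ∫ ω, f (fun i => x r ω i) ∂P = 0 := by
  have hmp := h.measurePreserving_flip r J
  have h0 : ∫ ω, f (fun i => x r ω i) ∂P = ∫ v, f v ∂(P.map fun ω i => x r ω i) :=
    (integral_map (h.measurable_coeff r).aemeasurable hf.aestronglyMeasurable).symm
  have h1 : ∫ v, f v ∂(P.map fun ω i => x r ω i)
      = ∫ v, f (flip J v) ∂(P.map fun ω i => x r ω i) := by
    conv_lhs => rw [← hmp.map_eq]
    exact integral_map hmp.measurable.aemeasurable hf.aestronglyMeasurable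
  -- Invariance of the law and oddness make the integral equal to its own negative.
  simp only [hodd, integral_neg] at h1
  rw [h0]; linarith

/-- Hoeffding's lemma for a centered variable with values `±c`. The variance proxy vanishes off the
support, so a sum over many columns costs only the energy on `S r`, a set small enough for the
restricted isometry property. -/
lemma hasSubgaussianMGF_coeff_mul (h : IsRademacherOn P S x) (r : Fin N) (i : Fin m) (c : ℝ) :
    HasSubgaussianMGF (fun ω => x r ω i * c) (if i ∈ S r then ‖c‖₊ ^ 2 else 0) P := by
  have := h.isProbabilityMeasure
  by_cases hi : i ∈ S r
  · have h0 : ∫ ω, x r ω i * c ∂P = 0 :=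
      h.integral_eq_zero_of_flip_eq_neg r {i} (f := fun v => v i * c)
        (by fun_prop) (fun v => by simp [DictTest.flip])
    have := hasSubgaussianMGF_of_mem_Icc_of_integral_eq_zero (μ := P) (a := -|c|) (b := |c|)
      ((h.measurable r i).mul_const c).aemeasurable (by
        filter_upwards [h.ae_isSignOn r] with ω hω
        rcases hω.1 i hi with h1 | h1 <;>
          simp only [h1] <;> constructor <;>
          linarith [neg_abs_le c, le_abs_self c]) h0
    convert this using 1
    rw [if_pos hi]
    congr 1
    apply NNReal.coe_injective
    push_cast
    rw [show |c| - -|c| = 2 * |c| by ring]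
    simp
  · simp only [h.eq_zero r i hi, zero_mul, hi, if_false]
    exact HasSubgaussianMGF.fun_zero

/-- Hoeffding's inequality for a signed sum within a single sample. -/
lemma measureReal_abs_sum_coeff_gt_le (h : IsRademacherOn P S x) (r : Fin N)
    (T : Finset (Fin m)) (w : Fin m → ℝ) {t σ : ℝ} (ht : 0 ≤ t)
    (hσ : ∑ i ∈ T with i ∈ S r, w i ^ 2 ≤ σ) (hσ0 : 0 < σ) :
    P.real {ω | t < |∑ i ∈ T, x r ω i * w i|} ≤ 2 * Real.exp (-t ^ 2 / (2 * σ)) := by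
  have := h.isProbabilityMeasure
  have one : ∀ w' : Fin m → ℝ, (∀ i, w' i ^ 2 = w i ^ 2) →
      P.real {ω | t ≤ ∑ i ∈ T, x r ω i * w' i} ≤ Real.exp (-t ^ 2 / (2 * σ)) := by
    intro w' hw'
    have hind : iIndepFun (fun i ω => x r ω i * w' i) P :=
      (h.indep.precomp (g := fun i => (r, i)) (fun a b hab => by simpa using hab)).comp
        (fun i t => t * w' i) (fun i => measurable_id.mul_const _)
    have hsum := HasSubgaussianMGF.sum_of_iIndepFun hind (s := T)
      (fun i _ => h.hasSubgaussianMGF_coeff_mul r i (w' i))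
    have hs : ((∑ i ∈ T, if i ∈ S r then ‖w' i‖₊ ^ 2 else 0 : NNReal) : ℝ)
        = ∑ i ∈ T with i ∈ S r, w i ^ 2 := by
      rw [← Finset.sum_filter]
      push_cast
      refine Finset.sum_congr rfl fun i _ => ?_
      rw [Real.norm_eq_abs, sq_abs, hw']
    have hsub : HasSubgaussianMGF (fun ω => ∑ i ∈ T, x r ω i * w' i) ⟨σ, hσ0.le⟩ P :=
      ⟨hsum.integrable_exp_mul, fun t => (hsum.mgf_le t).trans <| Real.exp_le_exp.2 <| by
        rw [hs]
        change _ ≤ σ * t ^ 2 / 2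
        gcongr⟩
    exact hsub.measure_ge_le ht
  calc P.real {ω | t < |∑ i ∈ T, x r ω i * w i|}
      ≤ P.real ({ω | t ≤ ∑ i ∈ T, x r ω i * w i} ∪ {ω | t ≤ ∑ i ∈ T, x r ω i * -w i}) := by
        refine measureReal_mono (fun ω hω => ?_) (measure_ne_top _ _)
        rcases lt_abs.1 (show t < _ from hω) with h1 | h1
        · exact Or.inl h1.le
        · right
          simp only [mul_neg, Finset.sum_neg_distrib, Set.mem_ofPred_eq]
          exact h1.le
    _ ≤ _ := measureReal_union_le _ _
    _ ≤ _ := by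
        have h1 := one w (fun _ => rfl)
        have h2 := one (fun i => -w i) (fun i => by ring)
        linarith

end IsRademacherOn


/-! ### Counting independent events -/

section Count

variable {Ω β : Type*} [MeasurableSpace Ω] [MeasurableSpace β] {P : Measure Ω} {N : ℕ}
  {ξ : Fin N → Ω → β} {E : Fin N → Set β}

-- The count is a sum of independent indicators. Each has moment generating function `1 + (exp t -
-- 1) * p ≤ exp ((exp t - 1) * p)`, and these bounds multiply. The probabilities may vary with the
-- sample, as the supports are arbitrary.
open Classical in
lemma mgf_count_le (hξ : iIndepFun ξ P) (hm : ∀ r, Measurable (ξ r))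
    (hE : ∀ r, MeasurableSet (E r)) (R : Finset (Fin N)) (t : ℝ) :
    mgf (fun ω => ((R.filter fun r => ξ r ω ∈ E r).card : ℝ)) P t ≤
      Real.exp ((Real.exp t - 1) * ∑ r ∈ R, P.real {ω | ξ r ω ∈ E r}) := by
  have := hξ.isProbabilityMeasure
  let f : Fin N → Ω → ℝ := fun r ω => (E r).indicator (fun _ => 1) (ξ r ω)
  have hfm : ∀ r, Measurable (f r) := fun r =>
    (measurable_const.indicator (hE r)).comp (hm r)
  have hfind : iIndepFun f P := hξ.comp (fun r => (E r).indicator fun _ => (1 : ℝ))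
    fun r => measurable_const.indicator (hE r)
  have hcount : (fun ω => ((R.filter fun r => ξ r ω ∈ E r).card : ℝ)) = ∑ r ∈ R, f r := by
    funext ω
    rw [Finset.sum_apply, Finset.card_filter]
    push_cast
    exact Finset.sum_congr rfl fun r _ => by simp [f, Set.indicator_apply]
  have hone : ∀ r, mgf (f r) P t ≤ Real.exp ((Real.exp t - 1) * P.real {ω | ξ r ω ∈ E r}) := by
    intro r
    have hms : MeasurableSet {ω | ξ r ω ∈ E r} := hm r (hE r)
    have h1 : mgf (f r) P t = 1 + (Real.exp t - 1) * P.real {ω | ξ r ω ∈ E r} := by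
      have : (fun ω => Real.exp (t * f r ω)) =
          fun ω => 1 + ({ω | ξ r ω ∈ E r}).indicator (fun _ => Real.exp t - 1) ω := by
        funext ω
        by_cases hω : ξ r ω ∈ E r <;> simp [f, Set.indicator_apply, hω]
      rw [mgf, this, integral_add (integrable_const _)
        ((integrable_const _).indicator hms), integral_indicator hms]
      simp [mul_comm]
    rw [h1, add_comm]
    exact Real.add_one_le_exp _
  rw [hcount, hfind.mgf_sum hfm, Finset.mul_sum, Real.exp_sum]
  exact Finset.prod_le_prod (fun _ _ => mgf_nonneg) fun r _ => hone r

open Classical in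
lemma integrable_exp_count (hξ : iIndepFun ξ P) (hm : ∀ r, Measurable (ξ r))
    (hE : ∀ r, MeasurableSet (E r)) (R : Finset (Fin N)) (t : ℝ) :
    Integrable (fun ω => Real.exp (t * ((R.filter fun r => ξ r ω ∈ E r).card : ℝ))) P := by
  have := hξ.isProbabilityMeasure
  have hmeas : Measurable fun ω => ((R.filter fun r => ξ r ω ∈ E r).card : ℝ) := by
    simp only [Finset.card_filter, Nat.cast_sum]
    refine Finset.measurable_sum _ fun r _ => ?_
    exact (measurable_from_top (f := ((↑) : ℕ → ℝ))).comp
      (Measurable.ite (hm r (hE r)) measurable_const measurable_const)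
  refine Integrable.of_bound (hmeas.const_mul t).exp.aestronglyMeasurable (Real.exp (|t| * R.card)) (ae_of_all _ fun ω => ?_)
  rw [Real.norm_eq_abs, Real.abs_exp, Real.exp_le_exp]
  have h1 : ((R.filter fun r => ξ r ω ∈ E r).card : ℝ) ≤ R.card := by
    exact_mod_cast Finset.card_filter_le _ _
  calc t * _ ≤ |t| * ((R.filter fun r => ξ r ω ∈ E r).card : ℝ) := by
        gcongr; exact le_abs_self t
    _ ≤ _ := by gcongr

open Classical in
/-- Chernoff's bound for the upper tail. -/
lemma measureReal_two_mul_le_count_le (hξ : iIndepFun ξ P) (hm : ∀ r, Measurable (ξ r))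
    (hE : ∀ r, MeasurableSet (E r)) (R : Finset (Fin N)) {μ : ℝ}
    (hμ : ∑ r ∈ R, P.real {ω | ξ r ω ∈ E r} ≤ μ) :
    P.real {ω | 2 * μ ≤ ((R.filter fun r => ξ r ω ∈ E r).card : ℝ)} ≤ Real.exp (-μ / 3) := by
  have := hξ.isProbabilityMeasure
  have hμ0 : 0 ≤ μ := le_trans (Finset.sum_nonneg fun _ _ => measureReal_nonneg) hμ
  refine (measure_ge_le_exp_mul_mgf (2 * μ) (Real.log_nonneg (by norm_num : (1 : ℝ) ≤ 2))
    (integrable_exp_count hξ hm hE R _)).trans ?_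
  refine (mul_le_mul_of_nonneg_left (mgf_count_le hξ hm hE R _) (Real.exp_pos _).le).trans ?_
  rw [← Real.exp_add, Real.exp_log (by norm_num), Real.exp_le_exp]
  -- At `t = log 2` the exponent is at most `-(2 log 2 - 1) μ`, and `2 log 2 - 1 > 1/3`.
  have := Real.log_two_gt_d9
  nlinarith

open Classical in
/-- Chernoff's bound for the lower tail. -/
lemma measureReal_count_le_half_le (hξ : iIndepFun ξ P) (hm : ∀ r, Measurable (ξ r))
    (hE : ∀ r, MeasurableSet (E r)) (R : Finset (Fin N)) {μ : ℝ} (hμ0 : 0 ≤ μ)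
    (hμ : μ ≤ ∑ r ∈ R, P.real {ω | ξ r ω ∈ E r}) :
    P.real {ω | ((R.filter fun r => ξ r ω ∈ E r).card : ℝ) ≤ μ / 2} ≤ Real.exp (-μ / 8) := by
  have := hξ.isProbabilityMeasure
  refine (measure_le_le_exp_mul_mgf (t := -Real.log 2) (μ / 2)
    (neg_nonpos.2 (Real.log_nonneg (by norm_num : (1 : ℝ) ≤ 2)))
    (integrable_exp_count hξ hm hE R _)).trans ?_
  refine (mul_le_mul_of_nonneg_left (mgf_count_le hξ hm hE R _) (Real.exp_pos _).le).trans ?_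
  rw [← Real.exp_add, Real.exp_neg, Real.exp_log (by norm_num), Real.exp_le_exp]
  -- At `t = -log 2` the exponent is at most `-(1 - log 2) μ / 2`, and `1 - log 2 > 1/4`.
  have := Real.log_two_lt_d9
  nlinarith

end Count

/-! ### Concentration over the samples -/

namespace IsRademacherOn

variable {Ω : Type*} [MeasurableSpace Ω] {P : Measure Ω} {N m : ℕ}
  {S : Fin N → Finset (Fin m)} {x : Fin N → Ω → Vec m}

/-- Hoeffding's inequality over the samples, for a statistic that is odd under a flip. -/
lemma measureReal_abs_sum_samples_gt_le (h : IsRademacherOn P S x) (R : Finset (Fin N))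
    (J : Finset (Fin m)) {f : (Fin m → ℝ) → ℝ} (hf : Measurable f)
    (hodd : ∀ v, f (flip J v) = -f v) (hbd : ∀ S' v, IsSignOn S' v → |f v| ≤ 1) {t : ℝ}
    (ht : 0 ≤ t) :
    P.real {ω | t < |∑ r ∈ R, f (fun i => x r ω i)|} ≤
      2 * Real.exp (-t ^ 2 / (2 * R.card)) := by
  have := h.isProbabilityMeasure
  have one : ∀ c : ℝ, |c| = 1 →
      P.real {ω | t ≤ ∑ r ∈ R, c * f (fun i => x r ω i)} ≤
        Real.exp (-t ^ 2 / (2 * R.card)) := by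
    intro c hc
    have hind : iIndepFun (fun r ω => c * f (fun i => x r ω i)) P :=
      h.iIndepFun_coeff.comp (fun _ v => c * f v) (fun _ => hf.const_mul c)
    have hsub : ∀ r ∈ R, HasSubgaussianMGF (fun ω => c * f (fun i => x r ω i)) 1 P := by
      intro r _
      have := hasSubgaussianMGF_of_mem_Icc_of_integral_eq_zero (μ := P) (a := -1) (b := 1)
        (X := fun ω => c * f (fun i => x r ω i))
        ((hf.comp (h.measurable_coeff r)).const_mul c).aemeasurable (by
          filter_upwards [h.ae_isSignOn r] with ω hω
          rw [Set.mem_Icc, ← abs_le, abs_mul, hc, one_mul]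
          exact hbd _ _ hω) (by
          rw [integral_const_mul, h.integral_eq_zero_of_flip_eq_neg r J hf hodd, mul_zero])
      convert this using 1
      apply NNReal.coe_injective
      push_cast
      norm_num
    refine (HasSubgaussianMGF.measure_sum_ge_le_of_iIndepFun hind hsub ht).trans_eq ?_
    simp
  calc P.real {ω | t < |∑ r ∈ R, f (fun i => x r ω i)|}
      ≤ P.real ({ω | t ≤ ∑ r ∈ R, 1 * f (fun i => x r ω i)} ∪
          {ω | t ≤ ∑ r ∈ R, -1 * f (fun i => x r ω i)}) := by
        refine measureReal_mono (fun ω hω => ?_) (measure_ne_top _ _)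
        rcases lt_abs.1 (show t < _ from hω) with h1 | h1
        · left; simpa using h1.le
        · right; simpa using h1.le
    _ ≤ _ := measureReal_union_le _ _
    _ ≤ _ := by
        have h1 := one 1 (by simp)
        have h2 := one (-1) (by simp)
        linarith

end IsRademacherOn


/-! ### Consequences of the restricted isometry property -/

section RIP

variable {n m k : ℕ} {A : Fin m → Vec n} {δ : ℝ}

lemma inner_synth (A : Fin m → Vec n) (z : Vec n) (c : Vec m) :
    inner ℝ z (synth A c) = ∑ i, c i * inner ℝ z (A i) := by
  simp [synth, inner_sum, real_inner_smul_right]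

lemma IsRIP.nonneg (hA : IsRIP A k δ) (hk : 1 ≤ k) (hm : 1 ≤ m) : 0 ≤ δ := by
  have h := hA (EuclideanSpace.single ⟨0, hm⟩ 1) (by
    refine le_trans (Set.ncard_le_ncard (t := {⟨0, hm⟩}) ?_) (by simpa using hk)
    intro i hi
    by_contra h
    exact hi (by simp at h; simp [h]))
  have h1 : ‖(EuclideanSpace.single (⟨0, hm⟩ : Fin m) (1 : ℝ))‖ = 1 := by simp
  rw [h1] at h
  linarith [h.1, h.2]

/-- Duality: if `c` is the vector of correlations on `T`, then `‖c‖² = ⟨u, A c⟩ ≤ ‖u‖ (1 + δ) ‖c‖`,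
and one factor `‖c‖` cancels. -/
lemma IsRIP.sum_inner_sq_le (hA : IsRIP A k δ) (hδ : 0 ≤ δ) {T : Finset (Fin m)}
    (hT : T.card ≤ k) (u : Vec n) :
    ∑ j ∈ T, inner ℝ u (A j) ^ 2 ≤ (1 + δ) ^ 2 * ‖u‖ ^ 2 := by
  let c : Vec m := WithLp.toLp 2 fun j => if j ∈ T then inner ℝ u (A j) else 0
  have hc : ‖c‖ ^ 2 = ∑ j ∈ T, inner ℝ u (A j) ^ 2 := by
    rw [EuclideanSpace.norm_sq_eq, ← Finset.sum_subset (Finset.subset_univ T)]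
    · exact Finset.sum_congr rfl fun j hj => by simp [c, hj]
    · intro j _ hj; simp [c, hj]
  have h1 : inner ℝ u (synth A c) = ‖c‖ ^ 2 := by
    rw [inner_synth, hc, ← Finset.sum_subset (Finset.subset_univ T)]
    · exact Finset.sum_congr rfl fun j hj => by simp [c, hj]; ring
    · intro j _ hj; simp [c, hj]
  have h2 : ‖synth A c‖ ≤ (1 + δ) * ‖c‖ := by
    refine (hA c ?_).2
    refine le_trans (Set.ncard_le_ncard (t := (T : Set (Fin m))) ?_) (by simpa using hT)
    intro j hj
    by_contra h
    exact hj (by simp [c, show j ∉ T from h])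
  have h3 := real_inner_le_norm u (synth A c)
  rw [h1] at h3
  rw [← hc]
  have h4 : ‖c‖ ^ 2 ≤ (1 + δ) * ‖u‖ * ‖c‖ := by
    nlinarith [norm_nonneg u, norm_nonneg c]
  have h5 : ‖c‖ ≤ (1 + δ) * ‖u‖ := by
    rcases (norm_nonneg c).eq_or_lt with h0 | h0
    · rw [← h0]; positivity
    · nlinarith
  calc ‖c‖ ^ 2 ≤ ((1 + δ) * ‖u‖) ^ 2 := by gcongr
    _ = _ := by ring

/-- Adjoining `i` to `T` adds the term `⟨A i, A i⟩² = 1`, while the enlarged sum is at most `(1 +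
δ)² ≤ 1 + 3 δ`. -/
lemma IsRIP.sum_inner_column_sq_le_of_lt (hA : IsRIP A k δ) (hδ : 0 ≤ δ) (hδ1 : δ ≤ 1)
    (hunit : ∀ i, ‖A i‖ = 1) {T : Finset (Fin m)} (hT : T.card < k) {i : Fin m} (hi : i ∉ T) :
    ∑ j ∈ T, inner ℝ (A i) (A j) ^ 2 ≤ 3 * δ := by
  have h := hA.sum_inner_sq_le hδ (T := insert i T)
    (by rw [Finset.card_insert_of_notMem hi]; omega) (A i)
  rw [Finset.sum_insert hi, real_inner_self_eq_norm_sq, hunit] at h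
  nlinarith

/-- A set of full size `k` leaves no room to adjoin `i`, so one element is split off and treated
alone; that singleton must have fewer than `k` elements, whence `2 ≤ k`. -/
lemma IsRIP.sum_inner_column_sq_le (hA : IsRIP A k δ) (hδ : 0 ≤ δ) (hδ1 : δ ≤ 1)
    (hunit : ∀ i, ‖A i‖ = 1) (hk : 2 ≤ k) {T : Finset (Fin m)} (hT : T.card ≤ k) {i : Fin m}
    (hi : i ∉ T) : ∑ j ∈ T, inner ℝ (A i) (A j) ^ 2 ≤ 6 * δ := by
  rcases T.eq_empty_or_nonempty with rfl | ⟨j, hj⟩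
  · simpa using hδ
  · rw [← Finset.add_sum_erase T _ hj]
    have hc := Finset.card_erase_of_mem hj
    have hpos := Finset.card_pos.2 ⟨j, hj⟩
    have h1 := hA.sum_inner_column_sq_le_of_lt hδ hδ1 hunit (T := T.erase j) (by omega)
      (fun h => hi (Finset.mem_of_mem_erase h))
    have h2 := hA.sum_inner_column_sq_le_of_lt hδ hδ1 hunit (T := {j}) (i := i)
      (by simp; omega) (by simp; rintro rfl; exact hi hj)
    simp only [Finset.sum_singleton] at h2
    linarith

/-- Near a column, the correlations with the other columns have small energy. -/
lemma IsRIP.sum_inner_sq_le_of_near (hA : IsRIP A k δ) (hδ : 0 ≤ δ) (hδ1 : δ ≤ 1 / 10)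
    (hunit : ∀ i, ‖A i‖ = 1) (hk : 2 ≤ k) {T : Finset (Fin m)} (hT : T.card ≤ k) {i : Fin m}
    (hi : i ∉ T) (z : Vec n) {b : ℝ} (hb : b ^ 2 = 1) :
    ∑ j ∈ T, inner ℝ z (A j) ^ 2 ≤ 12 * δ + 3 * ‖z - b • A i‖ ^ 2 := by
  have h1 := hA.sum_inner_sq_le hδ hT (z - b • A i)
  have h2 := hA.sum_inner_column_sq_le hδ (by linarith) hunit hk hT hi
  have h3 : ∑ j ∈ T, inner ℝ z (A j) ^ 2 ≤
      ∑ j ∈ T, (2 * inner ℝ (z - b • A i) (A j) ^ 2 + 2 * inner ℝ (A i) (A j) ^ 2) := by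
    refine Finset.sum_le_sum fun j _ => ?_
    have e : inner ℝ z (A j) = inner ℝ (z - b • A i) (A j) + b * inner ℝ (A i) (A j) := by
      rw [inner_sub_left, real_inner_smul_left]; ring
    rw [e]
    nlinarith [sq_nonneg (inner ℝ (z - b • A i) (A j) - b * inner ℝ (A i) (A j)), hb]
  rw [Finset.sum_add_distrib, ← Finset.mul_sum, ← Finset.mul_sum] at h3
  have h4 : (1 + δ) ^ 2 ≤ 3 / 2 := by nlinarith
  nlinarith [sq_nonneg ‖z - b • A i‖]

end RIP

/-! ### Means of selected samples -/

section Mean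

variable {n m k N : ℕ} {A : Fin m → Vec n}

lemma norm_synth_le (hunit : ∀ i, ‖A i‖ = 1) {S : Finset (Fin m)} (hS : S.card ≤ k) {c : Vec m}
    (hc : IsSignOn S fun i => c i) : ‖synth A c‖ ≤ k := by
  calc ‖synth A c‖ ≤ ∑ i, ‖c i • A i‖ := norm_sum_le _ _
    _ = ∑ i, |c i| := by simp [norm_smul, hunit]
    _ = ∑ i ∈ S, |c i| := by
        refine (Finset.sum_subset (Finset.subset_univ S) fun i _ hi => ?_).symm
        simpa using hc.2 i hi
    _ ≤ ∑ i ∈ S, 1 := Finset.sum_le_sum fun i _ => hc.abs_le_one i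
    _ ≤ k := by simpa using hS

/-- `v` has the prescribed values `b` on `I`. -/
def AgreesOn {m : ℕ} (I : Finset (Fin m)) (b v : Fin m → ℝ) : Prop := ∀ i ∈ I, v i = b i

open Classical in
/-- If few of the selected samples differ from the samples that agree with the signs `b` on `I`,
and the other coordinates average out, then the mean of the selected samples is close to
`∑ i ∈ I, b i • A i`. -/
lemma norm_meanOf_sub_le (hunit : ∀ i, ‖A i‖ = 1) {S : Fin N → Finset (Fin m)}
    (hS : ∀ r, (S r).card ≤ k) {c : Fin N → Vec m} (hc : ∀ r, IsSignOn (S r) fun i => c r i)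
    {I : Finset (Fin m)} {b : Fin m → ℝ} (hb : ∀ i ∈ I, |b i| = 1) (p : Fin N → Prop)
    {M s D : ℝ} (hM : 0 < M) (hs : 0 ≤ s) (hm : 1 ≤ m)
    (hT : M / 8 ≤ (Finset.univ.filter fun r => AgreesOn I b fun i => c r i).card)
    (hoff : ∀ l ∉ I, |∑ r ∈ Finset.univ.filter (fun r => AgreesOn I b fun i => c r i), c r l| ≤
      s * M / m)
    (hD : ((Finset.univ.filter fun r => ¬(p r ↔ AgreesOn I b fun i => c r i)).card : ℝ) ≤ D)
    (hDM : D ≤ M / 16) :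
    ‖meanOf (fun r => synth A (c r)) p - ∑ i ∈ I, b i • A i‖ ≤
      16 * (s * M + D * (k + I.card)) / M := by
  set T := Finset.univ.filter fun r => AgreesOn I b fun i => c r i with hTdef
  set U := Finset.univ.filter p with hU
  set W := Finset.univ.filter fun r => ¬(p r ↔ AgreesOn I b fun i => c r i) with hW
  set v := ∑ i ∈ I, b i • A i with hv
  set y : Fin N → Vec n := fun r => synth A (c r) with hy
  have hvn : ‖v‖ ≤ I.card := by
    calc ‖v‖ ≤ ∑ i ∈ I, ‖b i • A i‖ := norm_sum_le _ _
      _ = ∑ i ∈ I, 1 := Finset.sum_congr rfl fun i hi => by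
          rw [norm_smul, hunit, Real.norm_eq_abs, hb i hi, one_mul]
      _ = I.card := by simp
  have hyv : ∀ r, ‖y r - v‖ ≤ k + I.card := fun r =>
    (norm_sub_le _ _).trans (add_le_add (norm_synth_le hunit (hS r) (hc r)) hvn)
  -- On agreeing samples the `I`-part of `A x` is exactly `v`. The remaining coefficients are summed
  -- over the samples before norms are taken, so that their cancellation is kept.
  have hsumT : ∑ r ∈ T, (y r - v) = ∑ l ∈ Iᶜ, (∑ r ∈ T, c r l) • A l := by
    have : ∀ r ∈ T, y r - v = ∑ l ∈ Iᶜ, c r l • A l := by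
      intro r hr
      have hr' : AgreesOn I b fun i => c r i := (Finset.mem_filter.1 hr).2
      rw [hy, hv, sub_eq_iff_eq_add]
      simp only [synth]
      rw [← Finset.sum_compl_add_sum I]
      congr 1
      exact Finset.sum_congr rfl fun i hi => by rw [show c r i = b i from hr' i hi]
    rw [Finset.sum_congr rfl this, Finset.sum_comm]
    exact Finset.sum_congr rfl fun l _ => (Finset.sum_smul ..).symm
  have hTn : ‖∑ r ∈ T, (y r - v)‖ ≤ s * M := by
    rw [hsumT]
    have hm0 : (0 : ℝ) < m := by exact_mod_cast hm
    calc _ ≤ ∑ l ∈ Iᶜ, ‖(∑ r ∈ T, c r l) • A l‖ := norm_sum_le _ _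
      _ ≤ ∑ l ∈ Iᶜ, s * M / m := Finset.sum_le_sum fun l hl => by
          rw [norm_smul, hunit, mul_one, Real.norm_eq_abs]
          exact hoff l (Finset.mem_compl.1 hl)
      _ ≤ ∑ l : Fin m, s * M / m :=
          Finset.sum_le_sum_of_subset_of_nonneg (Finset.subset_univ _) fun _ _ _ => by positivity
      _ = s * M := by simp; field_simp
  have hdiff : ∑ r ∈ U, (y r - v) =
      ∑ r ∈ T, (y r - v) + ∑ r ∈ W, (if p r then (1 : ℝ) else -1) • (y r - v) := by
    rw [hU, hTdef, hW, Finset.sum_filter, Finset.sum_filter, Finset.sum_filter,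
      ← Finset.sum_add_distrib]
    refine Finset.sum_congr rfl fun r _ => ?_
    by_cases h1 : p r <;> by_cases h2 : AgreesOn I b fun i => c r i <;> simp [h1, h2]
  have hWn : ‖∑ r ∈ W, (if p r then (1 : ℝ) else -1) • (y r - v)‖ ≤ D * (k + I.card) := by
    calc _ ≤ ∑ r ∈ W, ‖(if p r then (1 : ℝ) else -1) • (y r - v)‖ := norm_sum_le _ _
      _ ≤ ∑ r ∈ W, ((k : ℝ) + I.card) := Finset.sum_le_sum fun r _ => by
          rw [norm_smul]
          have : ‖(if p r then (1 : ℝ) else -1)‖ = 1 := by split_ifs <;> simp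
          rw [this, one_mul]; exact hyv r
      _ = W.card * (k + I.card) := by rw [Finset.sum_const, nsmul_eq_mul]
      _ ≤ _ := by gcongr
  -- `#U ≥ #T - #W ≥ M / 8 - M / 16`.
  have hcardU : M / 16 ≤ U.card := by
    have h1 : T ⊆ U ∪ W := by
      intro r hr
      have hr' := (Finset.mem_filter.1 hr).2
      by_cases hp : p r
      · exact Finset.mem_union_left _ (by simp [hU, hp])
      · refine Finset.mem_union_right _ ?_
        rw [hW, Finset.mem_filter]
        exact ⟨Finset.mem_univ _, fun h => hp (h.2 hr')⟩
    have h2 : (T.card : ℝ) ≤ U.card + W.card := by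
      exact_mod_cast (Finset.card_le_card h1).trans (Finset.card_union_le _ _)
    linarith
  have hU0 : (0 : ℝ) < U.card := lt_of_lt_of_le (by positivity) hcardU
  have hmean : meanOf y p - v = (U.card : ℝ)⁻¹ • ∑ r ∈ U, (y r - v) := by
    rw [meanOf, Finset.sum_sub_distrib, smul_sub, Finset.sum_const, ← Nat.cast_smul_eq_nsmul ℝ,
      smul_smul, inv_mul_cancel₀ hU0.ne', one_smul]
  have hD0 : 0 ≤ D := le_trans (Nat.cast_nonneg _) hD
  rw [hmean, norm_smul, hdiff, norm_inv, Real.norm_of_nonneg hU0.le, inv_mul_le_iff₀ hU0]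
  calc _ ≤ s * M + D * (k + I.card) := (norm_add_le _ _).trans (add_le_add hTn hWn)
    _ = M / 16 * (16 * (s * M + D * (k + I.card)) / M) := by field_simp
    _ ≤ _ := by gcongr

end Mean


/-! ### Flipping coordinates of a signed sum -/

/-- The correlation `∑ i, v i * w i` avoids both the center and the windows around `±1`. -/
def IsBad {m : ℕ} (w : Fin m → ℝ) (η : ℝ) (v : Fin m → ℝ) : Prop :=
  |∑ i, v i * w i| ∉ Set.Icc (1 - η) (1 + η) ∪ Set.Icc 0 (η / 32)

section Flip

variable {m : ℕ} {w v : Fin m → ℝ} {η : ℝ}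

lemma isBad_iff : IsBad w η v ↔ ¬(1 - η ≤ |∑ i, v i * w i| ∧ |∑ i, v i * w i| ≤ 1 + η) ∧
    ¬|∑ i, v i * w i| ≤ η / 32 := by
  simp [IsBad]

lemma measurableSet_isBad (w : Fin m → ℝ) (η : ℝ) : MeasurableSet {v | IsBad w η v} := by
  have hm : Measurable fun v : Fin m → ℝ => |∑ i, v i * w i| := by fun_prop
  exact hm (measurableSet_Icc.union measurableSet_Icc).compl

lemma flip_empty (v : Fin m → ℝ) : flip ∅ v = v := by funext i; simp [flip]

/-- A coordinate that can be flipped without leaving the good region is close to `0`, `1/2` or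
`1` in absolute value. -/
lemma abs_cases_of_not_isBad (hη : η < 1 / 100) {S : Finset (Fin m)}
    (hv : IsSignOn S v) {i : Fin m} (hi : i ∈ S) (h0 : ¬IsBad w η v)
    (h1 : ¬IsBad w η (flip {i} v)) : |w i| ≤ η ∨ |2 * |w i| - 1| ≤ 2 * η ∨ 1 - η ≤ |w i| := by
  have e0 : ∑ j, v j * w j = v i * w i + ∑ j ∈ Finset.univ.erase i, v j * w j :=
    (Finset.add_sum_erase _ _ (Finset.mem_univ i)).symm
  have e1 : ∑ j, flip {i} v j * w j = -(v i * w i) + ∑ j ∈ Finset.univ.erase i, v j * w j := by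
    rw [← Finset.add_sum_erase _ _ (Finset.mem_univ i)]
    congr 1
    · simp [flip]
    · refine Finset.sum_congr rfl fun j hj => ?_
      simp [flip, Finset.ne_of_mem_erase hj]
  rw [isBad_iff, e0] at h0
  rw [isBad_iff, e1] at h1
  have ha : |v i * w i| = |w i| := by
    rcases hv.1 i hi with h | h <;> simp [h]
  rw [← ha]
  generalize v i * w i = a at *
  generalize ∑ j ∈ Finset.univ.erase i, v j * w j = R at *
  clear ha hv e0 e1
  rw [abs_le (a := 2 * |a| - 1)]
  -- The good region consists of three intervals around `0`, `1` and `-1`. Both `R + a` and `R - a`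
  -- lie in it, so their difference `2 a` is close to `0`, `±1` or `±2`; the nine pairs of intervals
  -- are checked below.
  have hcover : ∀ t : ℝ, ¬(¬(1 - η ≤ |t| ∧ |t| ≤ 1 + η) ∧ ¬|t| ≤ η / 32) →
      (1 - η ≤ t ∧ t ≤ 1 + η) ∨ (1 - η ≤ -t ∧ -t ≤ 1 + η) ∨ (-(η / 32) ≤ t ∧ t ≤ η / 32) := by
    intro t ht
    by_cases hc : |t| ≤ η / 32
    · exact Or.inr (Or.inr (abs_le.1 hc))
    · have h2 : 1 - η ≤ |t| ∧ |t| ≤ 1 + η := by tauto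
      rcases abs_cases t with ⟨h, _⟩ | ⟨h, _⟩ <;> rw [h] at h2
      · exact Or.inl h2
      · exact Or.inr (Or.inl h2)
  by_contra hcon
  simp only [not_or, not_and, not_le] at hcon
  obtain ⟨k1, k2, k3⟩ := hcon
  rcases hcover _ h0 with h0 | h0 | h0 <;> rcases hcover _ h1 with h1 | h1 | h1 <;>
    rcases abs_cases a with ⟨ha, _⟩ | ⟨ha, _⟩ <;> rw [ha] at k1 k2 k3 <;>
    first
    | linarith [h0.1, h0.2, h1.1, h1.2]
    | (have := k2 (by linarith [h0.1, h0.2, h1.1, h1.2])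
       linarith [h0.1, h0.2, h1.1, h1.2])

/-- The signs on `I` can be chosen so that all the terms on `I` add up with the rest. -/
lemma exists_flip_abs_sum_ge {S I : Finset (Fin m)} (hv : IsSignOn S v) (hI : I ⊆ S)
    (w : Fin m → ℝ) : ∃ K ⊆ I, ∑ i ∈ I, |w i| ≤ |∑ i, flip K v i * w i| := by
  classical
  set R := ∑ i ∈ Iᶜ, v i * w i with hR
  obtain ⟨e, he, heR⟩ : ∃ e : ℝ, (e = 1 ∨ e = -1) ∧ 0 ≤ e * R := by
    rcases le_total 0 R with h | h
    · exact ⟨1, Or.inl rfl, by simpa using h⟩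
    · exact ⟨-1, Or.inr rfl, by linarith⟩
  -- `e` is a sign of the part off `I`; flipping the terms of the opposite sign aligns all of `I`
  -- with it.
  refine ⟨I.filter fun i => e * (v i * w i) < 0, Finset.filter_subset _ _, ?_⟩
  set K := I.filter fun i => e * (v i * w i) < 0 with hK
  have h1 : ∑ i, flip K v i * w i = R + ∑ i ∈ I, flip K v i * w i := by
    rw [← Finset.sum_compl_add_sum I, hR]
    congr 1
    refine Finset.sum_congr rfl fun i hi => ?_
    have : i ∉ K := fun h => Finset.mem_compl.1 hi (Finset.filter_subset _ _ h)
    simp [flip, this]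
  have h2 : e * ∑ i ∈ I, flip K v i * w i = ∑ i ∈ I, |w i| := by
    rw [Finset.mul_sum]
    refine Finset.sum_congr rfl fun i hi => ?_
    have habs : |e * (v i * w i)| = |w i| := by
      rcases he with h | h <;> rcases hv.1 i (hI hi) with h' | h' <;> simp [h, h']
    by_cases hneg : e * (v i * w i) < 0
    · have : i ∈ K := Finset.mem_filter.2 ⟨hi, hneg⟩
      rw [← habs, abs_of_neg hneg]
      simp [flip, this]
    · have : i ∉ K := fun h => hneg (Finset.mem_filter.1 h).2
      rw [← habs, abs_of_nonneg (not_lt.1 hneg)]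
      simp [flip, this]
  have habs : |∑ i, flip K v i * w i| = |e * ∑ i, flip K v i * w i| := by
    rcases he with h | h <;> simp [h]
  rw [habs, h1, mul_add, h2]
  exact le_trans (by linarith) (le_abs_self _)

/-- The flips that act arbitrarily on `H` and on an initial segment of the complement. -/
def pathFlips {m : ℕ} (H : Finset (Fin m)) : Finset (Finset (Fin m)) :=
  (H.powerset ×ˢ Finset.range (m + 1)).image fun p =>
    p.1 ∪ Finset.univ.filter fun j => j.val < p.2 ∧ j ∉ H

lemma card_pathFlips_le {H : Finset (Fin m)} (hH : H.card ≤ 2) (hm : 1 ≤ m) :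
    (pathFlips H).card ≤ 8 * m := by
  refine Finset.card_image_le.trans ?_
  rw [Finset.card_product, Finset.card_powerset, Finset.card_range]
  -- At most four choices on `H` and `m + 1` initial segments: `4 (m + 1) ≤ 8 m`.
  have : 2 ^ H.card ≤ 2 ^ 2 := Nat.pow_le_pow_right (by norm_num) hH
  nlinarith

lemma empty_mem_pathFlips (H : Finset (Fin m)) : ∅ ∈ pathFlips H :=
  Finset.mem_image.2 ⟨(∅, 0), by simp, by simp⟩

/-- Along the path of flips the part of the sum off `H` moves from its value to the opposite value
in small steps, so that it comes close to every level in between. -/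
lemma exists_pathFlip (H : Finset (Fin m)) {K : Finset (Fin m)} (hK : K ⊆ H) {c : ℝ}
    (hc : 0 ≤ c) (hη : 0 ≤ η) (hw : ∀ j ∉ H, |v j * w j| ≤ η) :
    ∃ J ∈ pathFlips H, (∀ i ∈ H, flip J v i = flip K v i) ∧
      |∑ j ∈ Hᶜ, flip J v j * w j| ≤ c + 2 * η ∧
      (c < |∑ j ∈ Hᶜ, v j * w j| → c < |∑ j ∈ Hᶜ, flip J v j * w j|) := by
  classical
  set J : ℕ → Finset (Fin m) := fun t =>
    K ∪ Finset.univ.filter fun j => j.val < t ∧ j ∉ H with hJ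
  set R : ℕ → ℝ := fun t => ∑ j ∈ Hᶜ, flip (J t) v j * w j with hRdef
  have hJmem : ∀ t ≤ m, J t ∈ pathFlips H := fun t ht =>
    Finset.mem_image.2 ⟨(K, t), by simp [hK]; omega, rfl⟩
  have hJH : ∀ t, ∀ i ∈ H, flip (J t) v i = flip K v i := by
    intro t i hi; simp [flip, hJ, hi]
  have hval : ∀ t, ∀ j ∉ H, flip (J t) v j = if j.val < t then -v j else v j := by
    intro t j hj
    have : j ∉ K := fun h => hj (hK h)
    simp [flip, hJ, hj, this]
  have hR0 : R 0 = ∑ j ∈ Hᶜ, v j * w j :=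
    Finset.sum_congr rfl fun j hj => by rw [hval 0 j (Finset.mem_compl.1 hj)]; simp
  have hRm : R m = -∑ j ∈ Hᶜ, v j * w j := by
    rw [← Finset.sum_neg_distrib]
    exact Finset.sum_congr rfl fun j hj => by rw [hval m j (Finset.mem_compl.1 hj)]; simp
  have hstep : ∀ t < m, |R (t + 1) - R t| ≤ 2 * η := by
    intro t ht
    rw [hRdef]
    dsimp only
    rw [← Finset.sum_sub_distrib]
    have hz : ∀ j ∈ Hᶜ, j ≠ ⟨t, ht⟩ →
        flip (J (t + 1)) v j * w j - flip (J t) v j * w j = 0 := by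
      intro j hj hjt
      have hne : j.val ≠ t := fun h => hjt (Fin.ext h)
      rw [hval _ j (Finset.mem_compl.1 hj), hval _ j (Finset.mem_compl.1 hj)]
      have : j.val < t + 1 ↔ j.val < t := by omega
      simp [this]
    by_cases hmem : (⟨t, ht⟩ : Fin m) ∈ H
    · rw [Finset.sum_eq_zero fun j hj => hz j hj fun h => Finset.mem_compl.1 hj (h ▸ hmem)]
      simpa using hη
    · rw [Finset.sum_eq_single_of_mem _ (Finset.mem_compl.2 hmem) hz, hval _ _ hmem,
        hval _ _ hmem]
      have := hw _ hmem
      simp only [Nat.lt_succ_self, if_true, lt_irrefl, if_false]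
      rw [show -v ⟨t, ht⟩ * w ⟨t, ht⟩ - v ⟨t, ht⟩ * w ⟨t, ht⟩ = -(2 * (v ⟨t, ht⟩ * w ⟨t, ht⟩)) by
        ring, abs_neg, abs_mul, abs_two]
      linarith
  by_cases hsmall : |R 0| ≤ c
  · refine ⟨J 0, hJmem 0 (Nat.zero_le _), hJH 0, ?_, ?_⟩
    · change |R 0| ≤ _; linarith
    · intro h; rw [← hR0] at h; linarith
  obtain ⟨e, he, heR⟩ : ∃ e : ℝ, (e = 1 ∨ e = -1) ∧ e * R 0 = |R 0| := by
    rcases abs_choice (R 0) with h | h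
    · exact ⟨1, Or.inl rfl, by rw [h, one_mul]⟩
    · exact ⟨-1, Or.inr rfl, by rw [h]; ring⟩
  have habs : ∀ t, |e * t| = |t| := by
    intro t; rcases he with h | h <;> simp [h]
  -- The walk is stopped just before the first time at which `e * R t ≤ c`. Such a time exists
  -- because the value at `m` is the negative of the initial one, and it is not `0` because the walk
  -- starts above `c`. One step earlier the value exceeds `c` by at most `2 * η`.
  have hend : ∃ t, e * R t ≤ c := ⟨m, by rw [hRm, ← hR0]; linarith [abs_nonneg (R 0)]⟩
  have hfind := Nat.find_spec hend
  have hmin := fun t => Nat.find_min (m := t) hend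
  have hle : Nat.find hend ≤ m :=
    Nat.find_min' hend (by rw [hRm, ← hR0]; linarith [abs_nonneg (R 0)])
  generalize Nat.find hend = T at *
  obtain _ | t := T
  · exact absurd (heR ▸ hfind) hsmall
  have h1 : c < e * R t := not_le.1 (hmin t (Nat.lt_succ_self t))
  have h2 : |e * (R (t + 1) - R t)| ≤ 2 * η := by
    rw [habs]; exact hstep t hle
  have h3 := abs_le.1 h2
  have h4 : |R t| = e * R t := by
    rw [← habs (R t), abs_of_nonneg (by linarith)]
  refine ⟨J t, hJmem t (by omega), hJH t, ?_, fun _ => ?_⟩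
  · change |R t| ≤ _
    rw [h4]; linarith [h3.1]
  · change c < |R t|
    rw [h4]; exact h1

end Flip


/-! ### Correlations close to one half -/

section Halves

variable {m : ℕ} {w v : Fin m → ℝ} {η : ℝ} {S H : Finset (Fin m)}

lemma IsSignOn.abs_mul_le (hv : IsSignOn S v) (hw : ∀ j ∉ H, |w j| ≤ η) :
    ∀ j ∉ H, |v j * w j| ≤ η := fun j hj => by
  rw [abs_mul]
  have := hv.abs_le_one j
  have := hw j hj
  nlinarith [abs_nonneg (v j), abs_nonneg (w j)]

lemma sum_eq_sum_add_sum_compl (H : Finset (Fin m)) (w v : Fin m → ℝ) :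
    ∑ i, v i * w i = ∑ i ∈ H, v i * w i + ∑ i ∈ Hᶜ, v i * w i :=
  (Finset.sum_add_sum_compl H _).symm

/-- If the part of the sum on `H` can be made close to `±1/2`, then some flip is bad. -/
lemma exists_isBad_of_half (hη : 0 < η) (hη1 : η < 1 / 100) (hv : IsSignOn S v)
    (hw : ∀ j ∉ H, |w j| ≤ η) {K : Finset (Fin m)} (hK : K ⊆ H)
    (hd : |2 * |∑ i ∈ H, flip K v i * w i| - 1| ≤ 2 * η) :
    ∃ J ∈ pathFlips H, IsBad w η (flip J v) := by
  -- At level `c = 0` the part off `H` is brought to size at most `2 * η`, so the absolute value of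
  -- the whole sum is within `3 * η` of `1/2`.
  obtain ⟨J, hJ, hJH, hJR, -⟩ := exists_pathFlip H hK le_rfl hη.le (hv.abs_mul_le hw)
  refine ⟨J, hJ, ?_⟩
  rw [isBad_iff, sum_eq_sum_add_sum_compl H, Finset.sum_congr rfl fun i hi => by rw [hJH i hi]]
  generalize ∑ i ∈ H, flip K v i * w i = d at *
  generalize ∑ j ∈ Hᶜ, flip J v j * w j = R at *
  have h1 := abs_le.1 hd
  have h2 := abs_sub_abs_le_abs_add d R
  have h3 := abs_add_le d R
  exact ⟨fun h => by linarith [h.1], fun h => by linarith⟩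

/-- If the part of the sum on `H` can be made close to `0` and no flip is bad, then the part off
`H` is small. -/
lemma abs_sum_compl_le_of_forall_not_isBad (hη : 0 < η) (hη1 : η < 1 / 100) (hv : IsSignOn S v)
    (hw : ∀ j ∉ H, |w j| ≤ η) {K : Finset (Fin m)} (hK : K ⊆ H)
    (hd : |∑ i ∈ H, flip K v i * w i| ≤ 2 * η)
    (hgood : ∀ J ∈ pathFlips H, ¬IsBad w η (flip J v)) :
    |∑ j ∈ Hᶜ, v j * w j| ≤ 1 / 8 := by
  by_contra hlt
  rw [not_le] at hlt
  -- At level `c = 1/8` the part off `H` stops just above `1/8`; with at most `2 * η` from `H`, the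
  -- sum falls into the gap between `η / 32` and `1 - η`.
  obtain ⟨J, hJ, hJH, hJR, hJc⟩ := exists_pathFlip H hK (c := 1 / 8) (by norm_num) hη.le
    (hv.abs_mul_le hw)
  have hc := hJc hlt
  refine hgood J hJ ?_
  rw [isBad_iff, sum_eq_sum_add_sum_compl H, Finset.sum_congr rfl fun i hi => by rw [hJH i hi]]
  generalize ∑ i ∈ H, flip K v i * w i = d at *
  generalize ∑ j ∈ Hᶜ, flip J v j * w j = R at *
  have h2 := abs_sub_abs_le_abs_add R d
  have h3 := abs_add_le d R
  rw [add_comm R d] at h2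
  exact ⟨fun h => by linarith [h.1], fun h => by linarith⟩

/-- A sum of small terms cannot cross the gap without landing in it. Hence every sample with a
correlation near `±1` has a bad path flip, and such samples are rare. -/
lemma abs_sum_le_of_forall_not_isBad (hη : 0 < η) (hη1 : η < 1 / 100) (hv : IsSignOn S v)
    (hw : ∀ j, |w j| ≤ η) (hgood : ∀ J ∈ pathFlips (∅ : Finset (Fin m)), ¬IsBad w η (flip J v)) :
    |∑ j, v j * w j| ≤ 1 / 8 := by
  have := abs_sum_compl_le_of_forall_not_isBad (H := ∅) hη hη1 hv (fun j _ => hw j)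
    (Finset.Subset.refl _) (by simpa using hη.le) hgood
  simpa using this

/-- The small terms can be steered until they nearly cancel, which leaves only the coordinate of
size about `1/2`. -/
lemma exists_isBad_of_mem (hη : 0 < η) (hη1 : η < 1 / 100) (hv : IsSignOn S v) {i : Fin m}
    (hw : ∀ j ≠ i, |w j| ≤ η) (hi : i ∈ S) (hwi : |2 * |w i| - 1| ≤ 2 * η) :
    ∃ J ∈ pathFlips {i}, IsBad w η (flip J v) := by
  refine exists_isBad_of_half hη hη1 hv (fun j hj => hw j (by simpa using hj))
    (Finset.empty_subset _) ?_
  rw [flip_empty, Finset.sum_singleton, abs_mul]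
  have : |v i| = 1 := by rcases hv.1 i hi with h | h <;> simp [h]
  rwa [this, one_mul]

/-- With two coordinates close to `1/2`, outside the event that some flip is bad, the samples in
the window around `1` are those in which both coordinates contribute positively. -/
lemma mem_Ioo_iff_of_forall_not_isBad (hη : 0 < η) (hη1 : η < 1 / 100) (hv : IsSignOn S v)
    {i j : Fin m} (hij : i ≠ j) (hw : ∀ l, l ≠ i → l ≠ j → |w l| ≤ η)
    (hwi : |2 * |w i| - 1| ≤ 2 * η) (hwj : |2 * |w j| - 1| ≤ 2 * η) {b : Fin m → ℝ}
    (hb : ∀ l, b l = 1 ∨ b l = -1) (hbw : ∀ l, b l * w l = |w l|)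
    (hgood : ∀ J ∈ pathFlips {i, j}, ¬IsBad w η (flip J v)) :
    ∑ l, v l * w l ∈ Set.Ioo (1 - 10 * η) (1 + 10 * η) ↔ AgreesOn {i, j} b v := by
  have hw' : ∀ l ∉ ({i, j} : Finset (Fin m)), |w l| ≤ η := fun l hl => by
    simp only [Finset.mem_insert, Finset.mem_singleton, not_or] at hl
    exact hw l hl.1 hl.2
  have hgood0 : ¬IsBad w η v := by
    have := hgood ∅ (empty_mem_pathFlips _)
    rwa [flip_empty] at this
  have hsmall : ∀ K ⊆ ({i, j} : Finset (Fin m)), |flip K v i * w i + flip K v j * w j| ≤ 2 * η →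
      |∑ l ∈ ({i, j} : Finset (Fin m))ᶜ, v l * w l| ≤ 1 / 8 := fun K hK hd =>
    abs_sum_compl_le_of_forall_not_isBad hη hη1 hv hw' hK
      (by rwa [Finset.sum_pair hij]) hgood
  have hhalf : ¬|2 * |v i * w i + v j * w j| - 1| ≤ 2 * η := fun hd => by
    obtain ⟨J, hJ, hJb⟩ := exists_isBad_of_half hη hη1 hv hw' (Finset.empty_subset {i, j})
      (by rwa [flip_empty, Finset.sum_pair hij])
    exact hgood J hJ hJb
  have hval : ∀ l, l ∈ S → |2 * |w l| - 1| ≤ 2 * η →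
      (v l = b l ∧ v l * w l = |w l|) ∨ (v l ≠ b l ∧ v l * w l = -|w l|) := by
    intro l hl hwl
    rcases hv.1 l hl with h | h <;> rcases hb l with h' | h' <;> rw [h, h', ← hbw l, h'] <;>
      norm_num
  have hbi := abs_le.1 hwi
  have hbj := abs_le.1 hwj
  rw [isBad_iff] at hgood0
  have hagree : AgreesOn {i, j} b v ↔ v i = b i ∧ v j = b j := by simp [AgreesOn]
  rw [hagree]
  rw [sum_eq_sum_add_sum_compl {i, j}, Finset.sum_pair hij] at hgood0 ⊢
  by_cases hi : i ∈ S <;> by_cases hj : j ∈ S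
  -- The two halves cancel either as they stand or after flipping `i`; in both cases the part off
  -- the pair must be small.
  · have hfl : |∑ l ∈ ({i, j} : Finset (Fin m))ᶜ, v l * w l| ≤ 1 / 8 := by
      have hi' : flip {i} v i * w i = -(v i * w i) := by simp [flip]
      have hj' : flip {i} v j * w j = v j * w j := by simp [flip, hij.symm]
      rcases hval i hi hwi with ⟨-, h⟩ | ⟨-, h⟩ <;> rcases hval j hj hwj with ⟨-, h'⟩ | ⟨-, h'⟩
      · refine hsmall {i} (by simp) ?_
        rw [hi', hj', h, h', abs_le]; constructor <;> linarith
      · refine hsmall ∅ (by simp) ?_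
        rw [flip_empty, h, h', abs_le]; constructor <;> linarith
      · refine hsmall ∅ (by simp) ?_
        rw [flip_empty, h, h', abs_le]; constructor <;> linarith
      · refine hsmall {i} (by simp) ?_
        rw [hi', hj', h, h', abs_le]; constructor <;> linarith
    have hR := abs_le.1 hfl
    generalize ∑ l ∈ ({i, j} : Finset (Fin m))ᶜ, v l * w l = R at *
    by_cases hag : v i = b i ∧ v j = b j
    · have h1 : v i * w i = |w i| := by rw [hag.1, hbw]
      have h2 : v j * w j = |w j| := by rw [hag.2, hbw]
      rw [h1, h2] at hgood0 ⊢
      rw [abs_of_pos (by linarith)] at hgood0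
      refine iff_of_true ?_ hag
      -- The sum is within about `1/8` of `1`, hence far from the center; being good, it lies in the
      -- narrow window.
      have h3 : 1 - η ≤ |w i| + |w j| + R ∧ |w i| + |w j| + R ≤ 1 + η := by
        by_contra hcon
        exact hgood0 ⟨hcon, by linarith⟩
      exact ⟨by linarith [h3.1], by linarith [h3.2]⟩
    · refine iff_of_false (fun h => ?_) hag
      have h1 := h.1
      rcases hval i hi hwi with ⟨e, h⟩ | ⟨e, h⟩ <;> rcases hval j hj hwj with ⟨e', h'⟩ | ⟨e', h'⟩
      · exact hag ⟨e, e'⟩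
      all_goals rw [h, h'] at h1; linarith
  -- With only one of the two coordinates in the support, the pair contributes about `±1/2`, and
  -- some path flip is bad.
  · exfalso
    refine hhalf ?_
    have : |v i| = 1 := by rcases hv.1 i hi with h | h <;> simp [h]
    rw [hv.2 j hj, zero_mul, add_zero, abs_mul, this, one_mul]
    exact hwi
  · exfalso
    refine hhalf ?_
    have : |v j| = 1 := by rcases hv.1 j hj with h | h <;> simp [h]
    rw [hv.2 i hi, zero_mul, zero_add, abs_mul, this, one_mul]
    exact hwj
  · have hfl := hsmall ∅ (by simp) (by
      rw [flip_empty, hv.2 i hi, hv.2 j hj]; simpa using hη.le)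
    have hR := abs_le.1 hfl
    refine iff_of_false (fun h => ?_) (fun h => ?_)
    · have := h.1
      rw [hv.2 i hi, hv.2 j hj] at this
      linarith
    · rcases hb i with h' | h' <;> rw [hv.2 i hi, h'] at h <;> norm_num at h

end Halves


/-! ### Averaging over the samples with prescribed signs -/

lemma measurableSet_agreesOn {m : ℕ} (I : Finset (Fin m)) (b : Fin m → ℝ) :
    MeasurableSet {v | AgreesOn I b v} := by
  have : {v | AgreesOn I b v} = ⋂ i ∈ I, {v : Fin m → ℝ | v i = b i} := by
    ext v; simp [AgreesOn]
  rw [this]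
  refine Finset.measurableSet_biInter _ fun i _ => ?_
  have h : Measurable fun v : Fin m → ℝ => v i := by fun_prop
  exact h (measurableSet_singleton (b i))

lemma IsSignOn.subset_of_agreesOn {m : ℕ} {S I : Finset (Fin m)} {v b : Fin m → ℝ}
    (hv : IsSignOn S v) (hb : ∀ i, b i = 1 ∨ b i = -1) (h : AgreesOn I b v) : I ⊆ S := by
  intro i hi
  by_contra hiS
  have h1 := h i hi
  rw [hv.2 i hiS] at h1
  rcases hb i with h' | h' <;> rw [h'] at h1 <;> norm_num at h1

open Classical in
/-- The number of samples whose support contains `I`. -/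
noncomputable def coverCount {N m : ℕ} (S : Fin N → Finset (Fin m)) (I : Finset (Fin m)) : ℝ :=
  ((Finset.univ.filter fun r => I ⊆ S r).card : ℝ)

open Classical in
/-- The samples that agree with `b` on `I` are numerous and average out off `I`. -/
structure MeanGood {N m : ℕ} (S : Fin N → Finset (Fin m)) (I : Finset (Fin m)) (b : Fin m → ℝ)
    (s : ℝ) (c : Fin N → Vec m) : Prop where
  isSignOn : ∀ r, IsSignOn (S r) fun i => c r i
  card : coverCount S I / 8 ≤ ((Finset.univ.filter fun r => AgreesOn I b fun i => c r i).card : ℝ)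
  off : ∀ l ∉ I, |∑ r ∈ Finset.univ.filter (fun r => AgreesOn I b fun i => c r i), c r l| ≤
    s * coverCount S I / m

open Classical in
lemma MeanGood.norm_meanOf_sub_le {n m k N : ℕ} {A : Fin m → Vec n} (hunit : ∀ i, ‖A i‖ = 1)
    {S : Fin N → Finset (Fin m)} (hS : ∀ r, (S r).card ≤ k) {c : Fin N → Vec m}
    {I : Finset (Fin m)} {b : Fin m → ℝ} (hb : ∀ i, b i = 1 ∨ b i = -1) {s D : ℝ}
    (hc : MeanGood S I b s c) (p : Fin N → Prop) (hM : 0 < coverCount S I) (hs : 0 ≤ s)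
    (hm : 1 ≤ m)
    (hD : ((Finset.univ.filter fun r => ¬(p r ↔ AgreesOn I b fun i => c r i)).card : ℝ) ≤ D)
    (hDM : D ≤ coverCount S I / 16) :
    ‖meanOf (fun r => synth A (c r)) p - ∑ i ∈ I, b i • A i‖ ≤
      16 * s + 16 * D * (k + I.card) / coverCount S I := by
  refine (DictTest.norm_meanOf_sub_le hunit hS hc.isSignOn (fun i _ => ?_) p hM hs hm hc.card
    hc.off hD hDM).trans_eq ?_
  · rcases hb i with h | h <;> simp [h]
  · field_simp

section Event

variable {Ω : Type*} [MeasurableSpace Ω] {P : Measure Ω} {N m : ℕ}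
  {S : Fin N → Finset (Fin m)} {x : Fin N → Ω → Vec m}

/-- Flips of subsets of `I`, at most four of them, carry every sign vector to one that agrees with
`b`. -/
lemma IsRademacherOn.quarter_le_measureReal_agreesOn (h : IsRademacherOn P S x) {r : Fin N}
    {I : Finset (Fin m)} (hI : I.card ≤ 2) (hIS : I ⊆ S r) {b : Fin m → ℝ}
    (hb : ∀ i, b i = 1 ∨ b i = -1) :
    1 / 4 ≤ P.real {ω | (fun i => x r ω i) ∈ {v | AgreesOn I b v}} := by
  classical
  have := h.isProbabilityMeasure
  have key := h.measureReal_le_card_mul r I.powerset Set.univ (measurableSet_agreesOn I b)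
    fun v hv _ => by
      refine ⟨I.filter fun i => v i ≠ b i, by simp, fun i hi => ?_⟩
      by_cases hvi : v i = b i
      · simp [flip, hvi]
      · rcases hv.1 i (hIS hi) with h1 | h1 <;> rcases hb i with h2 | h2 <;>
          simp_all [flip]
  have hcard : (I.powerset.card : ℝ) ≤ 4 := by
    rw [Finset.card_powerset]
    have : 2 ^ I.card ≤ 2 ^ 2 := Nat.pow_le_pow_right (by norm_num) hI
    exact_mod_cast this
  simp only [Set.mem_univ, Set.ofPred_true, probReal_univ] at key
  have h0 : 0 ≤ P.real {ω | (fun i => x r ω i) ∈ {v | AgreesOn I b v}} := measureReal_nonneg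
  nlinarith

/-- At least a quarter of the covering samples are expected to agree, and Chernoff's lower tail
loses a factor two. For `l ∉ I`, the coordinate `l` restricted to agreeing samples is odd under the
flip of `l`, so Hoeffding over the samples applies; the factor `m` is the union bound over `l`. -/
lemma IsRademacherOn.measureReal_not_meanGood_le (h : IsRademacherOn P S x)
    {I : Finset (Fin m)} (hI : I.card ≤ 2) {b : Fin m → ℝ}
    (hb : ∀ i, b i = 1 ∨ b i = -1) {s : ℝ} (hs : 0 ≤ s) (hM : 0 < coverCount S I) :
    P.real {ω | ¬MeanGood S I b s fun r => x r ω} ≤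
      Real.exp (-coverCount S I / 32) +
        m * (2 * Real.exp (-(s ^ 2 * coverCount S I / (2 * m ^ 2)))) := by
  classical
  have := h.isProbabilityMeasure
  set M := coverCount S I with hMdef
  set R := Finset.univ.filter fun r => I ⊆ S r with hR
  have hRM : (R.card : ℝ) = M := by rw [hMdef, coverCount, hR]
  let f : Fin m → (Fin m → ℝ) → ℝ := fun l v => if AgreesOn I b v then v l else 0
  have hA : P.real {ω | ((R.filter fun r => (fun i => x r ω i) ∈ {v | AgreesOn I b v}).card : ℝ)
      ≤ M / 4 / 2} ≤ Real.exp (-(M / 4) / 8) := by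
    refine measureReal_count_le_half_le (E := fun _ => {v | AgreesOn I b v}) h.iIndepFun_coeff
      h.measurable_coeff (fun _ => measurableSet_agreesOn I b) R (by positivity) ?_
    calc M / 4 = ∑ r ∈ R, (1 / 4 : ℝ) := by rw [Finset.sum_const, nsmul_eq_mul, hRM]; ring
      _ ≤ _ := Finset.sum_le_sum fun r hr =>
        h.quarter_le_measureReal_agreesOn hI (Finset.mem_filter.1 hr).2 hb
  have hB : ∀ l ∈ Iᶜ, P.real {ω | s * M / m < |∑ r ∈ R, f l fun i => x r ω i|} ≤
      2 * Real.exp (-(s ^ 2 * M / (2 * m ^ 2))) := by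
    intro l hl
    rw [Finset.mem_compl] at hl
    refine (h.measureReal_abs_sum_samples_gt_le R {l} (f := f l)
      (Measurable.ite (measurableSet_agreesOn I b) (measurable_pi_apply l) measurable_const)
      (fun v => ?_) (fun S' v hv => ?_) (by positivity)).trans_eq ?_
    · have : AgreesOn I b (flip {l} v) ↔ AgreesOn I b v :=
        forall₂_congr fun i hi => by
          have : i ≠ l := fun e => hl (e ▸ hi)
          simp [flip, this]
      by_cases hag : AgreesOn I b v
      · simp [f, this, hag]; simp [flip]
      · simp [f, this, hag]
    · by_cases hag : AgreesOn I b v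
      · simpa [f, hag] using hv.abs_le_one l
      · simp [f, hag]
    · rw [hRM]
      have hm0 : (m : ℝ) ≠ 0 := by
        have := l.pos
        positivity
      congr 2
      field_simp
  have hsign : ∀ᵐ ω ∂P, ∀ r, IsSignOn (S r) fun i => x r ω i := ae_all_iff.2 h.ae_isSignOn
  calc P.real {ω | ¬MeanGood S I b s fun r => x r ω}
      ≤ P.real ({ω | ((R.filter fun r => (fun i => x r ω i) ∈ {v | AgreesOn I b v}).card : ℝ)
          ≤ M / 4 / 2} ∪ ⋃ l ∈ Iᶜ, {ω | s * M / m < |∑ r ∈ R, f l fun i => x r ω i|}) := by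
        refine ENNReal.toReal_mono (measure_ne_top _ _) (measure_mono_ae ?_)
        filter_upwards [hsign] with ω hω hbad
        by_contra hcon
        refine hbad ⟨hω, ?_, ?_⟩
        · have h1 : M / 4 / 2 < ((R.filter fun r =>
              (fun i => x r ω i) ∈ {v | AgreesOn I b v}).card : ℝ) := by
            by_contra h2
            exact hcon (Or.inl (not_lt.1 h2))
          refine le_trans (by linarith) (h1.le.trans ?_)
          exact_mod_cast Finset.card_le_card
            (Finset.filter_subset_filter _ (Finset.subset_univ R))
        · intro l hl
          have h1 : |∑ r ∈ R, f l fun i => x r ω i| ≤ s * M / m := by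
            by_contra h2
            refine hcon (Or.inr ?_)
            exact Set.mem_biUnion (show l ∈ ((Iᶜ : Finset (Fin m)) : Set (Fin m)) by simpa using hl)
              (not_le.1 h2)
          have h2 : ∑ r ∈ Finset.univ.filter (fun r => AgreesOn I b fun i => x r ω i), x r ω l
              = ∑ r ∈ R, f l fun i => x r ω i := by
            rw [Finset.sum_filter]
            -- Agreement forces `I ⊆ S r`, so samples outside `R` contribute nothing.
            refine (Finset.sum_subset (Finset.subset_univ R) fun r _ hr => ?_).symm
            have : ¬AgreesOn I b fun i => x r ω i := fun hag =>
              hr (Finset.mem_filter.2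
                ⟨Finset.mem_univ _, (hω r).subset_of_agreesOn hb hag⟩)
            simp [this]
          rw [h2]
          exact h1
    _ ≤ _ := measureReal_union_le _ _
    _ ≤ Real.exp (-(M / 4) / 8) + ∑ l ∈ Iᶜ, 2 * Real.exp (-(s ^ 2 * M / (2 * m ^ 2))) :=
        add_le_add hA ((measureReal_biUnion_finset_le _ _).trans (Finset.sum_le_sum hB))
    _ ≤ _ := by
        rw [Finset.sum_const, nsmul_eq_mul]
        have hc : ((Iᶜ : Finset (Fin m)).card : ℝ) ≤ m := by
          exact_mod_cast (Finset.card_le_univ _).trans_eq (Fintype.card_fin m)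
        have e : -(M / 4) / 8 = -M / 32 := by ring
        rw [e]
        gcongr

end Event


/-! ### Arithmetic of the parameters -/

/-- The assumptions on the parameters, the dictionary and the supports. -/
structure TestSetting (n m k N : ℕ) (A : Fin m → Vec n) (S : Fin N → Finset (Fin m))
    (γ η η₀ q₀ κ₀ δ : ℝ) : Prop where
  one_le_m : 1 ≤ m
  one_le_k : 1 ≤ k
  γ_pos : 0 < γ
  γ_le : γ ≤ 1 / 2
  η₀_pos : 0 < η₀
  η₀_lt : η₀ < η
  η_lt_one : η < 1
  q₀_pos : 0 < q₀
  sqrt_lt : √(Real.exp 10 * k / m) < η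
  η_lt : η < 1 / 1000 / Real.log (m * n / (q₀ * η₀)) ^ 2
  κ₀_eq : κ₀ = Real.exp (-1000) * η * q₀ / (k * m)
  N_ge : 10 ^ 6 * k * n * m * Real.log (1 / γ) / (η₀ ^ 3 * κ₀) ≤ N
  unit : ∀ i, ‖A i‖ = 1
  rip : IsRIP A k δ
  δ_lt : δ < (η / (16 * Real.log (1 / κ₀))) ^ 2
  card_le : ∀ r, (S r).card ≤ k
  cover : ∀ i₁ i₂ i₃ : Fin m,
    q₀ * N ≤ ({r | i₁ ∈ S r ∧ i₂ ∈ S r ∧ i₃ ∈ S r} : Finset (Fin N)).card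

namespace TestSetting

variable {n m k N : ℕ} {A : Fin m → Vec n} {S : Fin N → Finset (Fin m)}
  {γ η η₀ q₀ κ₀ δ : ℝ}

lemma η_pos (h : TestSetting n m k N A S γ η η₀ q₀ κ₀ δ) : 0 < η := h.η₀_pos.trans h.η₀_lt

lemma m_pos (h : TestSetting n m k N A S γ η η₀ q₀ κ₀ δ) : (0 : ℝ) < m := by
  exact_mod_cast h.one_le_m

lemma one_le_m_real (h : TestSetting n m k N A S γ η η₀ q₀ κ₀ δ) : (1 : ℝ) ≤ m := by
  exact_mod_cast h.one_le_m

lemma one_le_k_real (h : TestSetting n m k N A S γ η η₀ q₀ κ₀ δ) : (1 : ℝ) ≤ k := by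
  exact_mod_cast h.one_le_k

lemma one_le_n (h : TestSetting n m k N A S γ η η₀ q₀ κ₀ δ) : (1 : ℝ) ≤ n := by
  rcases Nat.eq_zero_or_pos n with rfl | hn
  · have h1 := h.unit ⟨0, h.one_le_m⟩
    rw [Subsingleton.elim (A ⟨0, h.one_le_m⟩) 0, norm_zero] at h1
    norm_num at h1
  · exact_mod_cast hn

lemma half_le_log (h : TestSetting n m k N A S γ η η₀ q₀ κ₀ δ) : 1 / 2 ≤ Real.log (1 / γ) := by
  have h1 : Real.log 2 ≤ Real.log (1 / γ) := by
    refine Real.log_le_log (by norm_num) ?_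
    rw [le_div_iff₀ h.γ_pos]
    linarith [h.γ_le]
  have := Real.log_two_gt_d9
  linarith

lemma exp_neg_log (h : TestSetting n m k N A S γ η η₀ q₀ κ₀ δ) :
    Real.exp (-Real.log (1 / γ)) = γ := by
  rw [Real.log_div one_ne_zero h.γ_pos.ne', Real.log_one, zero_sub, neg_neg,
    Real.exp_log h.γ_pos]

/-- Failure probabilities `exp (-4 log (1 / γ))` are negligible. -/
lemma exp_le_of_log_le (h : TestSetting n m k N A S γ η η₀ q₀ κ₀ δ) {t : ℝ}
    (ht : 4 * Real.log (1 / γ) ≤ t) : Real.exp (-t) ≤ γ / 8 := by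
  calc Real.exp (-t) ≤ Real.exp (-(4 * Real.log (1 / γ))) := Real.exp_le_exp.2 (by linarith)
    _ = γ ^ 4 := by
        rw [← h.exp_neg_log, ← Real.exp_nat_mul]
        rw [h.exp_neg_log]
        congr 1
        push_cast
        ring
    _ = γ * γ ^ 3 := by ring
    _ ≤ γ * (1 / 2) ^ 3 := by
        have := h.γ_le
        have := h.γ_pos
        gcongr
    _ = γ / 8 := by ring

/-- Since `η < 1`, the lower bound on `η` makes `m` large; this is the source of `10 ≤ L` in
`log_facts`. -/
lemma exp_ten_mul_lt (h : TestSetting n m k N A S γ η η₀ q₀ κ₀ δ) : Real.exp 10 * k < m := by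
  have h1 := (Real.sqrt_lt' h.η_pos).1 h.sqrt_lt
  have h2 : η ^ 2 < 1 := by have := h.η_pos; have := h.η_lt_one; nlinarith
  have h3 := h1.trans h2
  rwa [div_lt_one h.m_pos] at h3

lemma exp_ten_gt : (2 : ℝ) ≤ Real.exp 10 := by
  have := Real.add_one_le_exp (10 : ℝ); linarith

lemma k_le_m (h : TestSetting n m k N A S γ η η₀ q₀ κ₀ δ) : (k : ℝ) ≤ m := by
  have := h.exp_ten_mul_lt; have := exp_ten_gt; have := h.one_le_k_real
  nlinarith

lemma exp_ten_lt_m (h : TestSetting n m k N A S γ η η₀ q₀ κ₀ δ) : Real.exp 10 < m := by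
  have := h.exp_ten_mul_lt; have := exp_ten_gt; have := h.one_le_k_real
  nlinarith

lemma two_le_m (h : TestSetting n m k N A S γ η η₀ q₀ κ₀ δ) : 2 ≤ m := by
  have h1 := h.exp_ten_lt_m; have := exp_ten_gt
  exact_mod_cast (by linarith : (2 : ℝ) ≤ m)

lemma km_pos (h : TestSetting n m k N A S γ η η₀ q₀ κ₀ δ) : (0 : ℝ) < k * m :=
  mul_pos (by linarith [h.one_le_k_real]) h.m_pos

lemma κ₀_pos (h : TestSetting n m k N A S γ η η₀ q₀ κ₀ δ) : 0 < κ₀ := by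
  rw [h.κ₀_eq]
  have := h.η_pos; have := h.q₀_pos; have := h.km_pos
  positivity

lemma κ₀_mul (h : TestSetting n m k N A S γ η η₀ q₀ κ₀ δ) :
    κ₀ * (k * m) = Real.exp (-1000) * η * q₀ := by
  rw [h.κ₀_eq, div_mul_cancel₀ _ h.km_pos.ne']

lemma log_pos (h : TestSetting n m k N A S γ η η₀ q₀ κ₀ δ) : 0 < Real.log (1 / γ) := by
  linarith [h.half_le_log]

lemma κ₀_mul_N_ge (h : TestSetting n m k N A S γ η η₀ q₀ κ₀ δ) :
    10 ^ 6 * k * m * Real.log (1 / γ) ≤ κ₀ * N * η₀ ^ 3 := by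
  have h1 := h.N_ge
  have h2 : 0 < η₀ ^ 3 * κ₀ := mul_pos (pow_pos h.η₀_pos 3) h.κ₀_pos
  rw [div_le_iff₀ h2] at h1
  calc 10 ^ 6 * k * m * Real.log (1 / γ) = 10 ^ 6 * k * 1 * m * Real.log (1 / γ) := by ring
    _ ≤ 10 ^ 6 * k * n * m * Real.log (1 / γ) := by
        have := h.one_le_n; have := h.log_pos
        gcongr
    _ ≤ _ := h1
    _ = _ := by ring

lemma N_pos (h : TestSetting n m k N A S γ η η₀ q₀ κ₀ δ) : (0 : ℝ) < N := by
  have h1 := h.κ₀_mul_N_ge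
  have h2 : 0 < 10 ^ 6 * k * m * Real.log (1 / γ) := by
    have := h.km_pos; have := h.log_pos
    have : 0 < (k * m) * Real.log (1 / γ) := by positivity
    nlinarith
  rcases (Nat.cast_nonneg N : (0 : ℝ) ≤ N).eq_or_lt with h0 | h0
  · rw [← h0, mul_zero, zero_mul] at h1; linarith
  · exact h0

lemma q₀_le_one (h : TestSetting n m k N A S γ η η₀ q₀ κ₀ δ) : q₀ ≤ 1 := by
  have i : Fin m := ⟨0, h.one_le_m⟩
  have h1 := h.cover i i i
  have h2 : ((({r | i ∈ S r ∧ i ∈ S r ∧ i ∈ S r} : Finset (Fin N)).card : ℕ) : ℝ) ≤ N := by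
    exact_mod_cast (Finset.card_le_univ _).trans_eq (Fintype.card_fin N)
  have := h.N_pos
  nlinarith

/-- As `q₀ * N > 0`, some support contains two given distinct columns. -/
lemma two_le_k (h : TestSetting n m k N A S γ η η₀ q₀ κ₀ δ) : 2 ≤ k := by
  have hm := h.two_le_m
  let i : Fin m := ⟨0, by omega⟩
  let j : Fin m := ⟨1, by omega⟩
  have h1 := h.cover i j j
  have h2 : 0 < ((({r | i ∈ S r ∧ j ∈ S r ∧ j ∈ S r} : Finset (Fin N)).card : ℕ) : ℝ) :=
    lt_of_lt_of_le (mul_pos h.q₀_pos h.N_pos) h1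
  obtain ⟨r, hr⟩ := Finset.card_pos.1 (by exact_mod_cast h2)
  have hr' : i ∈ S r ∧ j ∈ S r ∧ j ∈ S r := by simpa using hr
  have h3 : ({i, j} : Finset (Fin m)) ⊆ S r := by
    intro l hl
    simp only [Finset.mem_insert, Finset.mem_singleton] at hl
    rcases hl with rfl | rfl
    exacts [hr'.1, hr'.2.1]
  have h4 := (Finset.card_le_card h3).trans (h.card_le r)
  rwa [Finset.card_pair (by simp [i, j])] at h4

/-- A lower bound for `L₀ = log (m n / (q₀ η₀))`, together with `q₀ η₀ ≥ m exp (-L₀)`. -/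
lemma log_facts (h : TestSetting n m k N A S γ η η₀ q₀ κ₀ δ) :
    ∃ L : ℝ, 10 ≤ L ∧ 1000 * L ^ 2 < 1 / η ∧ (m : ℝ) ≤ Real.exp L ∧
      m * Real.exp (-L) ≤ q₀ * η₀ := by
  have hq : 0 < q₀ * η₀ := mul_pos h.q₀_pos h.η₀_pos
  have hq1 : q₀ * η₀ ≤ 1 := by
    have := h.q₀_le_one; have := h.η₀_lt; have := h.η_lt_one; have := h.η₀_pos; have := h.q₀_pos
    nlinarith
  have hn := h.one_le_n
  have hm := h.m_pos
  have hpos : 0 < m * n / (q₀ * η₀) := by positivity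
  have hge : (m : ℝ) ≤ m * n / (q₀ * η₀) := by
    rw [le_div_iff₀ hq]
    calc (m : ℝ) * (q₀ * η₀) ≤ m * 1 := by gcongr
      _ ≤ m * n := by gcongr
  have hL10 : 10 ≤ Real.log (m * n / (q₀ * η₀)) := by
    rw [Real.le_log_iff_exp_le hpos]
    exact h.exp_ten_lt_m.le.trans hge
  refine ⟨Real.log (m * n / (q₀ * η₀)), hL10, ?_, ?_, ?_⟩
  · have h1 := h.η_lt
    have hη := h.η_pos
    rw [lt_div_iff₀ (by positivity)] at h1 ⊢
    linarith
  · rwa [Real.exp_log hpos]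
  · rw [Real.exp_neg, Real.exp_log hpos, inv_div, mul_div_assoc', div_le_iff₀ (by positivity)]
    calc m * (q₀ * η₀) = q₀ * η₀ * (m * 1) := by ring
      _ ≤ _ := by gcongr

lemma η_lt_small (h : TestSetting n m k N A S γ η η₀ q₀ κ₀ δ) : η < 1 / 100000 := by
  obtain ⟨L, h1, h2, -, -⟩ := h.log_facts
  have hη := h.η_pos
  rw [lt_div_iff₀ hη] at h2
  have : 100 ≤ L ^ 2 := by nlinarith
  nlinarith

lemma exp_neg_thousand_le : Real.exp (-1000) ≤ 1 / 10 ^ 6 := by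
  have h1 := Real.quadratic_le_exp_of_nonneg (x := 500) (by norm_num)
  have h2 : Real.exp (-1000) = (Real.exp 500 * Real.exp 500)⁻¹ := by
    rw [← Real.exp_add, ← Real.exp_neg]; norm_num
  rw [h2, inv_eq_one_div]
  gcongr
  nlinarith

lemma κ₀_mul_le (h : TestSetting n m k N A S γ η η₀ q₀ κ₀ δ) :
    κ₀ * (k * m) ≤ 1 / 10 ^ 6 * η * q₀ := by
  rw [h.κ₀_mul]
  have := h.η_pos; have := h.q₀_pos; have := exp_neg_thousand_le
  gcongr

lemma κ₀_mul_m_le (h : TestSetting n m k N A S γ η η₀ q₀ κ₀ δ) :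
    κ₀ * m ≤ 1 / 10 ^ 6 * η * q₀ := by
  refine le_trans ?_ h.κ₀_mul_le
  have h1 := h.one_le_k_real
  have h2 : 0 ≤ κ₀ * m := mul_nonneg h.κ₀_pos.le h.m_pos.le
  nlinarith

lemma κ₀_mul_m_le' (h : TestSetting n m k N A S γ η η₀ q₀ κ₀ δ) : κ₀ * m ≤ 1 / 10 ^ 9 * q₀ := by
  refine h.κ₀_mul_m_le.trans ?_
  have := h.η_lt_small; have := h.q₀_pos
  nlinarith

lemma κ₀_mul_le' (h : TestSetting n m k N A S γ η η₀ q₀ κ₀ δ) :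
    κ₀ * (k * m) ≤ 1 / 10 ^ 9 * q₀ := by
  refine h.κ₀_mul_le.trans ?_
  have := h.η_lt_small; have := h.q₀_pos
  nlinarith

lemma κ₀_le (h : TestSetting n m k N A S γ η η₀ q₀ κ₀ δ) : κ₀ ≤ 1 / 10 ^ 9 * q₀ := by
  refine le_trans ?_ h.κ₀_mul_m_le'
  have := h.one_le_m_real; have := h.κ₀_pos
  nlinarith

lemma exp_neg_log_κ₀ (h : TestSetting n m k N A S γ η η₀ q₀ κ₀ δ) :
    Real.exp (-Real.log (1 / κ₀)) = κ₀ := by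
  rw [Real.log_div one_ne_zero h.κ₀_pos.ne', Real.log_one, zero_sub, neg_neg,
    Real.exp_log h.κ₀_pos]

/-- The other factors of `κ₀` are at most one, so `κ₀ ≤ exp (-1000)`. In the completeness proof this
lets a tail with exponent a small multiple of `log (1 / κ₀) ^ 2` drop below `κ₀`. -/
lemma thousand_le_log_κ₀ (h : TestSetting n m k N A S γ η η₀ q₀ κ₀ δ) :
    1000 ≤ Real.log (1 / κ₀) := by
  have h1 : κ₀ ≤ Real.exp (-1000) := by
    have e := h.κ₀_mul
    have h2 : (1 : ℝ) ≤ k * m := by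
      have := h.one_le_k_real; have := h.one_le_m_real; nlinarith
    have h3 := h.κ₀_pos
    have h4 : η * q₀ ≤ 1 := by
      have := h.q₀_le_one; have := h.η_lt_one; have := h.η_pos; have := h.q₀_pos; nlinarith
    have h5 := Real.exp_pos (-1000)
    nlinarith
  rw [← h.exp_neg_log_κ₀, Real.exp_le_exp] at h1
  linarith

lemma δ_nonneg (h : TestSetting n m k N A S γ η η₀ q₀ κ₀ δ) : 0 ≤ δ :=
  h.rip.nonneg h.one_le_k h.one_le_m

lemma δ_mul_le (h : TestSetting n m k N A S γ η η₀ q₀ κ₀ δ) :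
    12 * δ ≤ 12 / 256 * (η / Real.log (1 / κ₀)) ^ 2 := by
  have h1 := h.δ_lt
  have : (η / (16 * Real.log (1 / κ₀))) ^ 2 = 1 / 256 * (η / Real.log (1 / κ₀)) ^ 2 := by
    rw [mul_comm (16 : ℝ), ← div_div]; ring
  linarith

lemma δ_le_η (h : TestSetting n m k N A S γ η η₀ q₀ κ₀ δ) : 12 * δ ≤ η := by
  refine h.δ_mul_le.trans ?_
  have h1 := h.thousand_le_log_κ₀
  have h2 := h.η_pos
  have h3 : η / Real.log (1 / κ₀) ≤ η := div_le_self h2.le (by linarith)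
  have h4 : 0 ≤ η / Real.log (1 / κ₀) := by positivity
  have := h.η_lt_one
  nlinarith

lemma δ_le_tenth (h : TestSetting n m k N A S γ η η₀ q₀ κ₀ δ) : δ ≤ 1 / 10 := by
  have := h.δ_le_η; have := h.η_lt_small; linarith

lemma κ₀_mul_N_ge' (h : TestSetting n m k N A S γ η η₀ q₀ κ₀ δ) :
    10 ^ 6 * Real.log (1 / γ) ≤ κ₀ * N := by
  have h1 := h.κ₀_mul_N_ge
  have h2 : η₀ ^ 3 ≤ 1 := pow_le_one₀ h.η₀_pos.le (h.η₀_lt.le.trans h.η_lt_one.le)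
  have h3 : 0 ≤ κ₀ * N := mul_nonneg h.κ₀_pos.le h.N_pos.le
  have h4 : (1 : ℝ) ≤ k * m := by
    have := h.one_le_k_real; have := h.one_le_m_real; nlinarith
  have h5 := h.log_pos
  calc 10 ^ 6 * Real.log (1 / γ) = 10 ^ 6 * 1 * Real.log (1 / γ) := by ring
    _ ≤ 10 ^ 6 * (k * m) * Real.log (1 / γ) := by gcongr
    _ = 10 ^ 6 * k * m * Real.log (1 / γ) := by ring
    _ ≤ _ := h1
    _ ≤ κ₀ * N * 1 := by gcongr
    _ = _ := mul_one _

/-- Inserting the value of `κ₀` squares the factor `k * m`. The `m ^ 2` is what Hoeffding needs to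
make each off-coordinate sum a `1 / m` fraction of the sample count. -/
lemma q₀_mul_N_ge (h : TestSetting n m k N A S γ η η₀ q₀ κ₀ δ) :
    10 ^ 6 * k ^ 2 * m ^ 2 * Real.log (1 / γ) ≤ q₀ * N * η * η₀ ^ 3 := by
  have h1 := h.κ₀_mul_N_ge
  have h2 := h.κ₀_mul_le
  have hk := h.km_pos
  have hη₀ := h.η₀_pos
  have hη := h.η_pos
  have hN := h.N_pos
  have hq := h.q₀_pos
  calc 10 ^ 6 * (k : ℝ) ^ 2 * m ^ 2 * Real.log (1 / γ)
      = 10 ^ 6 * k * m * Real.log (1 / γ) * (k * m) := by ring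
    _ ≤ κ₀ * N * η₀ ^ 3 * (k * m) := by gcongr
    _ = κ₀ * (k * m) * (N * η₀ ^ 3) := by ring
    _ ≤ 1 / 10 ^ 6 * η * q₀ * (N * η₀ ^ 3) := by gcongr
    _ ≤ 1 * η * q₀ * (N * η₀ ^ 3) := by gcongr; norm_num
    _ = _ := by ring

lemma q₀_mul_N_mul_η₀_ge (h : TestSetting n m k N A S γ η η₀ q₀ κ₀ δ) :
    10 ^ 6 * k ^ 2 * m ^ 2 * (Real.log (1 / γ) * (1 / η)) ≤ q₀ * N * η₀ ^ 2 := by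
  have h1 := h.q₀_mul_N_ge
  have hη := h.η_pos
  have hη₀ := h.η₀_pos
  have hη₀' : η₀ ≤ 1 := h.η₀_lt.le.trans h.η_lt_one.le
  have hN := h.N_pos
  have hq := h.q₀_pos
  calc 10 ^ 6 * (k : ℝ) ^ 2 * m ^ 2 * (Real.log (1 / γ) * (1 / η))
      = 10 ^ 6 * k ^ 2 * m ^ 2 * Real.log (1 / γ) / η := by ring
    _ ≤ q₀ * N * η * η₀ ^ 3 / η := by gcongr
    _ = q₀ * N * η₀ ^ 2 * η₀ := by field_simp
    _ ≤ q₀ * N * η₀ ^ 2 * 1 := by gcongr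
    _ = _ := mul_one _

lemma coverCount_ge (h : TestSetting n m k N A S γ η η₀ q₀ κ₀ δ) {I : Finset (Fin m)}
    {i₁ i₂ i₃ : Fin m} (hI : I ⊆ {i₁, i₂, i₃}) : q₀ * N ≤ coverCount S I := by
  classical
  refine (h.cover i₁ i₂ i₃).trans ?_
  rw [coverCount]
  refine Nat.cast_le.2 (Finset.card_le_card fun r hr => ?_)
  simp only [Finset.mem_filter, Finset.mem_univ, true_and] at hr ⊢
  intro i hi
  have := hI hi
  simp only [Finset.mem_insert, Finset.mem_singleton] at this
  rcases this with rfl | rfl | rfl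
  exacts [hr.1, hr.2.1, hr.2.2]

lemma q₀_mul_N_pos (h : TestSetting n m k N A S γ η η₀ q₀ κ₀ δ) : 0 < q₀ * N :=
  mul_pos h.q₀_pos h.N_pos

/-- The averaging event holds with high probability. -/
lemma measureReal_not_meanGood_le (h : TestSetting n m k N A S γ η η₀ q₀ κ₀ δ)
    {Ω : Type*} [MeasurableSpace Ω] {P : Measure Ω} {x : Fin N → Ω → Vec m}
    (hx : IsRademacherOn P S x) {I : Finset (Fin m)} (hI2 : I.card ≤ 2) {i₁ i₂ i₃ : Fin m}
    (hI : I ⊆ {i₁, i₂, i₃}) {b : Fin m → ℝ} (hb : ∀ i, b i = 1 ∨ b i = -1) :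
    P.real {ω | ¬MeanGood S I b (η₀ / 64) fun r => x r ω} ≤ γ / 4 := by
  have hM := h.coverCount_ge hI
  have hM0 := h.q₀_mul_N_pos.trans_le hM
  refine (hx.measureReal_not_meanGood_le hI2 hb (by linarith [h.η₀_pos] : 0 ≤ η₀ / 64)
    hM0).trans ?_
  obtain ⟨L, hL10, hLη, hmL, -⟩ := h.log_facts
  have hℓ := h.half_le_log
  have hm := h.m_pos
  have hk := h.one_le_k_real
  have hq := h.q₀_mul_N_pos
  have h0 := h.q₀_mul_N_mul_η₀_ge
  have hη := h.η_pos
  have hη₀ := h.η₀_pos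
  set ℓ := Real.log (1 / γ) with hℓdef
  set M := coverCount S I
  have hfirst : Real.exp (-M / 32) ≤ γ / 8 := by
    rw [neg_div]
    refine h.exp_le_of_log_le ?_
    have h1 := h.κ₀_mul_N_ge'
    have h2 : κ₀ * N ≤ q₀ * N := by
      have := h.κ₀_le; have := h.N_pos; have := h.q₀_pos
      gcongr; linarith
    rw [← hℓdef] at h1 ⊢
    linarith
  -- The exponent has to absorb both the union bound, as `m ≤ exp L`, and `4 * ℓ`; since `ℓ ≥ 1/2`
  -- and `L ≥ 10`, `100 * ℓ * L` does both.
  have hexp : 100 * ℓ * L ≤ (η₀ / 64) ^ 2 * M / (2 * m ^ 2) := by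
    rw [le_div_iff₀ (by positivity)]
    have e1 : (1 : ℝ) ≤ (k : ℝ) ^ 2 := one_le_pow₀ hk
    have e2 : 1000 * L ≤ 1 / η := by nlinarith
    calc 100 * ℓ * L * (2 * (m : ℝ) ^ 2) = m ^ 2 * (ℓ * (1000 * L)) / 5 := by ring
      _ ≤ m ^ 2 * (ℓ * (1 / η)) / 5 := by gcongr
      _ ≤ 10 ^ 6 * 1 * m ^ 2 * (ℓ * (1 / η)) / 4096 := by
          have : 0 ≤ (m : ℝ) ^ 2 * (ℓ * (1 / η)) := by positivity
          linarith
      _ ≤ 10 ^ 6 * k ^ 2 * m ^ 2 * (ℓ * (1 / η)) / 4096 := by gcongr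
      _ ≤ q₀ * N * η₀ ^ 2 / 4096 := by gcongr
      _ ≤ M * η₀ ^ 2 / 4096 := by gcongr
      _ = _ := by ring
  have hsecond : m * (2 * Real.exp (-((η₀ / 64) ^ 2 * M / (2 * m ^ 2)))) ≤ γ / 8 := by
    calc m * (2 * Real.exp (-((η₀ / 64) ^ 2 * M / (2 * m ^ 2))))
        ≤ Real.exp L * (Real.exp 1 * Real.exp (-(100 * ℓ * L))) := by
          have : (2 : ℝ) ≤ Real.exp 1 := by have := Real.add_one_le_exp (1 : ℝ); linarith
          gcongr
      _ = Real.exp (-(100 * ℓ * L - L - 1)) := by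
          rw [← Real.exp_add, ← Real.exp_add]; congr 1; ring
      _ ≤ γ / 8 := h.exp_le_of_log_le (by nlinarith)
  linarith

end TestSetting


/-! ### Correlations dominated by one column -/

section OneColumn

variable {m : ℕ} {w v : Fin m → ℝ} {S : Finset (Fin m)} {i : Fin m} {b η : ℝ}

lemma sum_eq_add_sum_erase (w v : Fin m → ℝ) (i : Fin m) :
    ∑ j, v j * w j = v i * w i + ∑ j ∈ Finset.univ.erase i, v j * w j :=
  (Finset.add_sum_erase _ _ (Finset.mem_univ i)).symm

/-- The dominant term has size at least `1 - η` and the rest at most `1/4`, so the threshold `1/2`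
reads off the sign at `i`. -/
lemma half_le_sum_iff (hv : IsSignOn S v) (hb : b = 1 ∨ b = -1) (hη : η < 1 / 100)
    (hw : 1 - η ≤ b * w i) (hR : |∑ j ∈ Finset.univ.erase i, v j * w j| ≤ 1 / 4) :
    1 / 2 ≤ ∑ j, v j * w j ↔ v i = b := by
  rw [sum_eq_add_sum_erase w v i]
  have hR' := abs_le.1 hR
  generalize ∑ j ∈ Finset.univ.erase i, v j * w j = R at *
  by_cases hi : i ∈ S
  · rcases hv.1 i hi with h | h <;> rcases hb with h' | h' <;> rw [h, h'] <;> rw [h'] at hw <;>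
      constructor <;> intro hh <;> linarith
  · rw [hv.2 i hi]
    constructor
    · intro hh; linarith
    · intro hh; rcases hb with h' | h' <;> rw [h'] at hh <;> norm_num at hh

/-- The other columns contribute at most `η / 32`: this just fits the central window when `i` is
absent, and is well within the slack `η / 2` of the window around `1` when it is present. -/
lemma sum_of_near (hv : IsSignOn S v) (hb : b = 1 ∨ b = -1) (hη : 0 < η) (hη1 : η < 1 / 100)
    (hw : 1 - η / 2 ≤ b * w i) (hw1 : b * w i ≤ 1)
    (hR : |∑ j ∈ Finset.univ.erase i, v j * w j| ≤ η / 32) :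
    (i ∈ S → 1 - η ≤ |∑ j, v j * w j| ∧ |∑ j, v j * w j| ≤ 1 + η) ∧
      (i ∉ S → |∑ j, v j * w j| ≤ η / 32) ∧
      (∑ j, v j * w j ∈ Set.Ioo (1 - 10 * η) (1 + 10 * η) ↔ v i = b) := by
  rw [sum_eq_add_sum_erase w v i]
  have hR' := abs_le.1 hR
  by_cases hi : i ∈ S
  · refine ⟨fun _ => ?_, fun h => absurd hi h, ?_⟩
    · have h1 : |v i * w i| = b * w i := by
        rw [← abs_of_pos (show 0 < b * w i by linarith), abs_mul, abs_mul]
        congr 1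
        rcases hv.1 i hi with h | h <;> rcases hb with h' | h' <;> simp [h, h']
      have h2 := abs_sub_abs_le_abs_add (v i * w i) (∑ j ∈ Finset.univ.erase i, v j * w j)
      have h3 := abs_add_le (v i * w i) (∑ j ∈ Finset.univ.erase i, v j * w j)
      constructor <;> linarith
    · generalize ∑ j ∈ Finset.univ.erase i, v j * w j = R at *
      rcases hv.1 i hi with h | h <;> rcases hb with h' | h' <;> rw [h, h'] <;>
        rw [h'] at hw hw1 <;> constructor <;> intro hh <;>
        first
        | rfl
        | (exfalso; linarith [hh.1])
        | (exfalso; linarith)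
        | (constructor <;> linarith)
  · rw [hv.2 i hi, zero_mul, zero_add]
    refine ⟨fun h => absurd h hi, fun _ => hR, fun hh => ?_, fun hh => ?_⟩
    · have := hh.1; linarith
    · rcases hb with h' | h' <;> rw [h'] at hh <;> norm_num at hh

end OneColumn

lemma fraction_eq {N : ℕ} (p : Fin N → Prop) [DecidablePred p] :
    fraction p = ((Finset.univ.filter p).card : ℝ) / N := by
  rw [fraction]
  congr

lemma fraction_lt_iff {N : ℕ} (hN : (0 : ℝ) < N) (p : Fin N → Prop) (κ : ℝ) [DecidablePred p] :
    fraction p < κ ↔ ((Finset.univ.filter p).card : ℝ) < κ * N := by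
  rw [fraction_eq, div_lt_iff₀ hN]

lemma le_fraction_iff {N : ℕ} (hN : (0 : ℝ) < N) (p : Fin N → Prop) (κ : ℝ) [DecidablePred p] :
    κ ≤ fraction p ↔ κ * N ≤ ((Finset.univ.filter p).card : ℝ) := by
  rw [fraction_eq, le_div_iff₀ hN]

/-- `b` and `z` with `⟨z, a⟩` determine the distance from `z` to `b • a`. -/
lemma norm_sub_smul_sq {n : ℕ} {z a : Vec n} (hz : ‖z‖ = 1) (ha : ‖a‖ = 1) {b : ℝ}
    (hb : b = 1 ∨ b = -1) : ‖z - b • a‖ ^ 2 = 2 - 2 * (b * inner ℝ z a) := by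
  rw [norm_sub_sq_real, hz, norm_smul, ha, real_inner_smul_right]
  rcases hb with h | h <;> rw [h] <;> norm_num <;> ring

/-! ### Completeness -/

namespace TestSetting

variable {n m k N : ℕ} {A : Fin m → Vec n} {S : Fin N → Finset (Fin m)}
  {γ η η₀ q₀ κ₀ δ : ℝ}
  {Ω : Type*} [MeasurableSpace Ω] {P : Measure Ω} {x : Fin N → Ω → Vec m}

open Classical in
/-- An upper bound on the number of samples in which a rare event happens. -/
lemma measureReal_count_ge_le (h : TestSetting n m k N A S γ η η₀ q₀ κ₀ δ)
    (hx : IsRademacherOn P S x) {E : Fin N → Set (Fin m → ℝ)} (hE : ∀ r, MeasurableSet (E r))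
    {μ : ℝ} (hμ : ∑ r, P.real {ω | (fun i => x r ω i) ∈ E r} ≤ μ)
    (hμ1 : 12 * Real.log (1 / γ) ≤ μ) :
    P.real {ω | 2 * μ ≤ ((Finset.univ.filter fun r => (fun i => x r ω i) ∈ E r).card : ℝ)} ≤
      γ / 8 := by
  refine (measureReal_two_mul_le_count_le hx.iIndepFun_coeff hx.measurable_coeff hE
    Finset.univ hμ).trans ?_
  rw [neg_div]
  exact h.exp_le_of_log_le (by linarith)

lemma measurableSet_rest (w : Fin m → ℝ) (i : Fin m) (t : ℝ) :
    MeasurableSet {v : Fin m → ℝ | t < |∑ j ∈ Finset.univ.erase i, v j * w j|} :=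
  measurableSet_lt measurable_const (by fun_prop)

/-- Near a column the contribution of the other columns is subgaussian. -/
lemma measureReal_rest_gt_le (h : TestSetting n m k N A S γ η η₀ q₀ κ₀ δ)
    (hx : IsRademacherOn P S x) (z : Vec n) (i : Fin m) {b t σ : ℝ} (hb : b = 1 ∨ b = -1)
    (ht : 0 ≤ t) (hσ0 : 0 < σ) (hσ : 12 * δ + 3 * ‖z - b • A i‖ ^ 2 ≤ σ) (r : Fin N) :
    P.real {ω | (fun j => x r ω j) ∈
      {v : Fin m → ℝ | t < |∑ j ∈ Finset.univ.erase i, v j * inner ℝ z (A j)|}} ≤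
      2 * Real.exp (-t ^ 2 / (2 * σ)) := by
  refine hx.measureReal_abs_sum_coeff_gt_le r (Finset.univ.erase i) (fun j => inner ℝ z (A j))
    ht (le_trans ?_ hσ) hσ0
  refine h.rip.sum_inner_sq_le_of_near h.δ_nonneg h.δ_le_tenth h.unit h.two_le_k ?_ (by simp) z
    (by rcases hb with h | h <;> rw [h] <;> norm_num)
  refine le_trans (Finset.card_le_card fun j hj => ?_) (h.card_le r)
  exact (Finset.mem_filter.1 hj).2

theorem completeness (h : TestSetting n m k N A S γ η η₀ q₀ κ₀ δ)
    (hx : IsRademacherOn P S x) {z : Vec n} (hz : ‖z‖ = 1) {i : Fin m} {b : ℝ}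
    (hb : b = 1 ∨ b = -1) (hnear : ‖z - b • A i‖ ≤ η / (8 * Real.log (1 / κ₀))) :
    P.real {ω | ¬∃ v, testColRad z (fun r => synth A (x r ω)) (2 * κ₀) (1 / 2 * η * q₀) η =
      some v} ≤ γ / 2 := by
  classical
  have := hx.isProbabilityMeasure
  set w : Fin m → ℝ := fun j => inner ℝ z (A j) with hw
  have hη := h.η_pos
  have hη1 := h.η_lt_small
  have hN := h.N_pos
  have hκ := h.κ₀_pos
  have hq := h.q₀_pos
  have hL := h.thousand_le_log_κ₀
  set L := Real.log (1 / κ₀) with hLdef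
  have hdist : ‖z - b • A i‖ ^ 2 ≤ 1 / 64 * (η / L) ^ 2 := by
    calc ‖z - b • A i‖ ^ 2 ≤ (η / (8 * L)) ^ 2 := by gcongr
      _ = _ := by rw [mul_comm (8 : ℝ), ← div_div]; ring
  have hηL : η / L ≤ η := div_le_self hη.le (by linarith)
  have hηL0 : 0 < η / L := by positivity
  have hwi := norm_sub_smul_sq hz (h.unit i) hb
  have hwi1 : b * w i ≤ 1 := by have := sq_nonneg ‖z - b • A i‖; simp only [hw]; linarith
  have hwi2 : 1 - η / 2 ≤ b * w i := by
    have : (η / L) ^ 2 ≤ η := by nlinarith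
    simp only [hw]; linarith
  set E : Set (Fin m → ℝ) := {v | η / 32 < |∑ j ∈ Finset.univ.erase i, v j * w j|} with hE
  have hEp : ∀ r, P.real {ω | (fun j => x r ω j) ∈ E} ≤ κ₀ := by
    intro r
    refine (h.measureReal_rest_gt_le hx z i hb (t := η / 32) (σ := (η / L) ^ 2 / 10)
      (by positivity) (by positivity) ?_ r).trans ?_
    -- `12 * δ` and `3 * ‖z - b • A i‖ ^ 2` are each at most `3/64 * (η / L) ^ 2`, in total less
    -- than a tenth.
    · have := h.δ_mul_le
      nlinarith [sq_nonneg (η / L)]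
    · have e : -(η / 32) ^ 2 / (2 * ((η / L) ^ 2 / 10)) = -(L ^ 2 * (5 / 1024)) := by
        field_simp; norm_num
      rw [e]
      have h2 : (2 : ℝ) ≤ Real.exp 1 := by have := Real.add_one_le_exp (1 : ℝ); linarith
      calc 2 * Real.exp (-(L ^ 2 * (5 / 1024)))
          ≤ Real.exp 1 * Real.exp (-(L ^ 2 * (5 / 1024))) := by gcongr
        _ = Real.exp (1 - L ^ 2 * (5 / 1024)) := by rw [← Real.exp_add]; rfl
        -- Here `L ≥ 1000` makes the quadratic term win: `1 - 5 L² / 1024 ≤ -L`.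
        _ ≤ Real.exp (-L) := Real.exp_le_exp.2 (by nlinarith)
        _ = κ₀ := h.exp_neg_log_κ₀
  have hcount := h.measureReal_count_ge_le hx (E := fun _ => E) (μ := κ₀ * N)
    (fun _ => measurableSet_rest w i _) (by
      calc _ ≤ ∑ r : Fin N, κ₀ := Finset.sum_le_sum fun r _ => hEp r
        _ = _ := by simp [mul_comm]) (by
      have := h.κ₀_mul_N_ge'; have := h.log_pos; linarith)
  have hmean := h.measureReal_not_meanGood_le hx (I := {i}) (i₁ := i) (i₂ := i) (i₃ := i)
    (by simp) (by simp) (b := fun _ => b) (fun _ => hb)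
  have hM : q₀ * N ≤ coverCount S {i} :=
    h.coverCount_ge (i₁ := i) (i₂ := i) (i₃ := i) (by simp)
  have hM0 := h.q₀_mul_N_pos.trans_le hM
  refine le_trans (measureReal_mono (fun ω hω => ?_) (measure_ne_top _ _) :
    _ ≤ P.real ({ω | 2 * (κ₀ * N) ≤
        ((Finset.univ.filter fun r => (fun i => x r ω i) ∈ E).card : ℝ)} ∪
      {ω | ¬MeanGood S {i} (fun _ => b) (η₀ / 64) fun r => x r ω}))
    ((measureReal_union_le _ _).trans (by linarith [h.γ_pos]))
  by_contra hcon
  simp only [Set.mem_union, Set.mem_ofPred_eq, not_or, not_le, not_not] at hcon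
  obtain ⟨hEc, hgood⟩ := hcon
  refine hω ?_
  have hX : ∀ r, inner ℝ z (synth A (x r ω)) = ∑ j, x r ω j * w j := fun r => inner_synth A z _
  have hX' : ∀ r, inner ℝ (synth A (x r ω)) z = ∑ j, x r ω j * w j := fun r => by
    rw [real_inner_comm, hX]
  have hsn : ∀ r, (fun j => x r ω j) ∉ E → _ := fun r hr =>
    sum_of_near (w := w) (hgood.isSignOn r) hb hη (by linarith) hwi2 hwi1 (not_lt.1 hr)
  have hc1 : fraction (fun r => |inner ℝ z (synth A (x r ω))| ∉
      Set.Icc (1 - η) (1 + η) ∪ Set.Icc 0 (η / 32)) < 2 * κ₀ := by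
    rw [fraction_lt_iff hN]
    refine lt_of_le_of_lt (Nat.cast_le.2 (Finset.card_le_card fun r hr => ?_))
      (hEc.trans_eq (by ring))
    simp only [Finset.mem_filter, Finset.mem_univ, true_and] at hr ⊢
    by_contra hrE
    have hs := hsn r hrE
    refine hr ?_
    rw [hX]
    by_cases hi : i ∈ S r
    · exact Or.inl (hs.1 hi)
    · exact Or.inr ⟨abs_nonneg _, hs.2.1 hi⟩
  have hc2 : 1 / 2 * η * q₀ ≤
      fraction (fun r => |inner ℝ z (synth A (x r ω))| ∈ Set.Icc (1 - η) (1 + η)) := by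
    rw [le_fraction_iff hN]
    -- Every sample covering `i` falls into the window unless it is one of the fewer than `2 κ₀ N`
    -- exceptional ones.
    have hsub : (Finset.univ.filter fun r => {i} ⊆ S r) ⊆
        (Finset.univ.filter fun r => |inner ℝ z (synth A (x r ω))| ∈ Set.Icc (1 - η) (1 + η)) ∪
        (Finset.univ.filter fun r => (fun i => x r ω i) ∈ E) := by
      intro r hr
      simp only [Finset.mem_filter, Finset.mem_univ, true_and, Finset.singleton_subset_iff,
        Finset.mem_union] at hr ⊢
      by_cases hrE : (fun i => x r ω i) ∈ E
      · exact Or.inr hrE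
      · left
        rw [hX]
        exact (hsn r hrE).1 hr
    have hcard : coverCount S {i} ≤
        ((Finset.univ.filter fun r => |inner ℝ z (synth A (x r ω))| ∈
          Set.Icc (1 - η) (1 + η)).card : ℝ) +
        ((Finset.univ.filter fun r => (fun i => x r ω i) ∈ E).card : ℝ) := by
      rw [coverCount]
      exact_mod_cast (Finset.card_le_card hsub).trans (Finset.card_union_le _ _)
    have h1 : κ₀ * N ≤ 1 / 10 ^ 9 * (q₀ * N) := by
      rw [← mul_assoc]; exact mul_le_mul_of_nonneg_right h.κ₀_le hN.le
    have h2 : 1 / 2 * η * q₀ * N ≤ 1 / 2 * (q₀ * N) := by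
      have := h.q₀_mul_N_pos
      have := h.η_lt_one
      nlinarith
    linarith [h.q₀_mul_N_pos]
  have hc3 : ‖meanOf (fun r => synth A (x r ω)) (fun r => inner ℝ (synth A (x r ω)) z ∈
      Set.Ioo (1 - 10 * η) (1 + 10 * η))‖ ≤ 1.1 := by
    have h1 : κ₀ * N ≤ 1 / 10 ^ 9 * (q₀ * N) := by
      rw [← mul_assoc]; exact mul_le_mul_of_nonneg_right h.κ₀_le hN.le
    have hb1 : |b| = 1 := by rcases hb with h | h <;> simp [h]
    have key := hgood.norm_meanOf_sub_le h.unit h.card_le (fun _ => hb)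
      (fun r => inner ℝ (synth A (x r ω)) z ∈ Set.Ioo (1 - 10 * η) (1 + 10 * η)) hM0
      (by linarith [h.η₀_pos]) h.one_le_m (D := 2 * (κ₀ * N)) (by
        refine le_trans (Nat.cast_le.2 (Finset.card_le_card fun r hr => ?_)) hEc.le
        simp only [Finset.mem_filter, Finset.mem_univ, true_and] at hr ⊢
        by_contra hrE
        refine hr ?_
        rw [hX', (hsn r hrE).2.2]
        simp [AgreesOn]) (by linarith)
    rw [Finset.sum_singleton, Finset.card_singleton] at key
    have h3 : 16 * (2 * (κ₀ * N)) * ((k : ℝ) + (1 : ℕ)) / coverCount S {i} ≤ 1 / 100 := by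
      rw [div_le_iff₀ hM0]
      have h4 : κ₀ * k ≤ 1 / 10 ^ 9 * q₀ := by
        refine le_trans ?_ h.κ₀_mul_le'
        have h5 := h.one_le_m_real
        have h6 : 0 ≤ κ₀ * k := by positivity
        nlinarith
      have h7 : κ₀ * k * N ≤ 1 / 10 ^ 9 * q₀ * N := mul_le_mul_of_nonneg_right h4 hN.le
      have h8 : κ₀ * N ≤ κ₀ * k * N := by
        have := h.one_le_k_real
        have h9 : 0 ≤ κ₀ * N := by positivity
        nlinarith
      push_cast
      nlinarith
    have h4 : ‖b • A i‖ = 1 := by rw [norm_smul, h.unit, Real.norm_eq_abs, hb1, one_mul]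
    have h5 := norm_le_norm_add_norm_sub' (meanOf (fun r => synth A (x r ω)) (fun r =>
      inner ℝ (synth A (x r ω)) z ∈ Set.Ioo (1 - 10 * η) (1 + 10 * η))) (b • A i)
    have h6 := h.η₀_lt
    rw [show (1.1 : ℝ) = 11 / 10 by norm_num]
    linarith
  rw [testColRad, if_pos ⟨hc1, hc2, hc3⟩]
  exact ⟨_, rfl⟩

end TestSetting


/-! ### Soundness -/

open Classical in
lemma testColRad_eq_some {n N : ℕ} {z : Vec n} {Y : Fin N → Vec n} {κ₀ κ₁ η : ℝ} {v : Vec n}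
    (hv : testColRad z Y κ₀ κ₁ η = some v) :
    fraction (fun r => |inner ℝ z (Y r)| ∉ Set.Icc (1 - η) (1 + η) ∪ Set.Icc 0 (η / 32)) < κ₀ ∧
      κ₁ ≤ fraction (fun r => |inner ℝ z (Y r)| ∈ Set.Icc (1 - η) (1 + η)) ∧
      ‖meanOf Y (fun r => inner ℝ (Y r) z ∈ Set.Ioo (1 - 10 * η) (1 + 10 * η))‖ ≤ 11 / 10 ∧
      v = ‖halfMean z Y‖⁻¹ • halfMean z Y := by
  rw [testColRad] at hv
  split_ifs at hv with hc
  refine ⟨hc.1, hc.2.1, hc.2.2.trans (by norm_num), (Option.some.inj hv).symm⟩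

/-- Rescaling to unit length moves `v` by `|‖v‖ - 1| ≤ ε`; the assumption `ε < 1` keeps `v` nonzero.
-/
lemma norm_normalize_sub_le {n : ℕ} {u v : Vec n} {ε : ℝ} (hu : ‖u‖ = 1) (hε : ε < 1)
    (h : ‖v - u‖ ≤ ε) : ‖‖v‖⁻¹ • v - u‖ ≤ 2 * ε := by
  have h1 : |‖v‖ - 1| ≤ ε := by rw [← hu]; exact (abs_norm_sub_norm_le v u).trans h
  have hv : 0 < ‖v‖ := by have := (abs_le.1 h1).1; linarith
  have h2 : ‖‖v‖⁻¹ • v - v‖ = |‖v‖ - 1| := by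
    have e : ‖v‖⁻¹ • v - v = (‖v‖⁻¹ - 1) • v := by rw [sub_smul, one_smul]
    have e2 : |‖v‖⁻¹ - 1| * ‖v‖ = |(‖v‖⁻¹ - 1) * ‖v‖| := by rw [abs_mul, abs_norm]
    rw [e, norm_smul, Real.norm_eq_abs, e2, sub_mul, inv_mul_cancel₀ hv.ne', one_mul, abs_sub_comm]
  calc ‖‖v‖⁻¹ • v - u‖ = ‖(‖v‖⁻¹ • v - v) + (v - u)‖ := by rw [sub_add_sub_cancel]
    _ ≤ ‖‖v‖⁻¹ • v - v‖ + ‖v - u‖ := norm_add_le _ _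
    _ ≤ 2 * ε := by rw [h2]; linarith

/-- The sign of a real number, with the value `1` at `0`. -/
noncomputable def signOf (t : ℝ) : ℝ := if 0 ≤ t then 1 else -1

lemma signOf_eq (t : ℝ) : signOf t = 1 ∨ signOf t = -1 := by
  unfold signOf; split_ifs <;> simp

lemma signOf_mul (t : ℝ) : signOf t * t = |t| := by
  unfold signOf; split_ifs with h
  · rw [abs_of_nonneg h, one_mul]
  · rw [abs_of_neg (not_le.1 h)]; ring

namespace TestSetting

variable {n m k N : ℕ} {A : Fin m → Vec n} {S : Fin N → Finset (Fin m)}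
  {γ η η₀ q₀ κ₀ δ : ℝ}
  {Ω : Type*} [MeasurableSpace Ω] {P : Measure Ω} {x : Fin N → Ω → Vec m}

/-- If `z` is strongly correlated with a column, then the mean of the selected samples recovers
that column. -/
lemma soundness_of_correlated (h : TestSetting n m k N A S γ η η₀ q₀ κ₀ δ)
    (hx : IsRademacherOn P S x) {z : Vec n} (hz : ‖z‖ = 1) {i : Fin m}
    (hi : 1 - η ≤ |inner ℝ z (A i)|) :
    P.real {ω | ¬∀ v, testColRad z (fun r => synth A (x r ω)) (2 * κ₀) (1 / 2 * η * q₀) η =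
      some v → ∃ i, ∃ b ∈ ({-1, 1} : Set ℝ), ‖z - b • A i‖ ≤ √(8 * η) ∧ ‖v - b • A i‖ ≤ η₀ ∧
        ‖halfMean z (fun r => synth A (x r ω)) - b • A i‖ ≤ η₀} ≤ γ / 2 := by
  classical
  have := hx.isProbabilityMeasure
  set w : Fin m → ℝ := fun j => inner ℝ z (A j) with hw
  set b := signOf (w i) with hbdef
  have hb : b = 1 ∨ b = -1 := signOf_eq _
  have hbw : 1 - η ≤ b * w i := by rw [hbdef, signOf_mul]; exact hi
  have hη := h.η_pos
  have hη1 := h.η_lt_small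
  have hη₀ := h.η₀_pos
  have hη₀' := h.η₀_lt
  have hN := h.N_pos
  have hq := h.q₀_pos
  have hk := h.one_le_k_real
  have hqN := h.q₀_mul_N_pos
  have hdist : ‖z - b • A i‖ ^ 2 ≤ 2 * η := by
    rw [norm_sub_smul_sq hz (h.unit i) hb]; simp only [hw] at hbw; linarith
  obtain ⟨L, hL10, hLη, -, hmL⟩ := h.log_facts
  -- Chosen so that `2 τ N` exceptional samples, each displaced by at most `k + 1 ≤ 2 k`, contribute
  -- at most `16 * 2 τ N * 2 k / (q₀ N) = η₀ / 4` to the error of the mean.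
  set τ := η₀ * q₀ / (256 * k) with hτ
  have hτ0 : 0 < τ := by positivity
  set E : Set (Fin m → ℝ) := {v | 1 / 4 < |∑ j ∈ Finset.univ.erase i, v j * w j|} with hE
  have hEp : ∀ r, P.real {ω | (fun j => x r ω j) ∈ E} ≤ τ := by
    intro r
    refine (h.measureReal_rest_gt_le hx z i hb (t := 1 / 4) (σ := 7 * η)
      (by positivity) (by positivity) (by linarith [h.δ_le_η]) r).trans ?_
    have e : -(1 / 4) ^ 2 / (2 * (7 * η)) = -(1 / η * (1 / 224)) := by
      field_simp; norm_num
    have h2 : (2 : ℝ) ≤ Real.exp 1 := by have := Real.add_one_le_exp (1 : ℝ); linarith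
    have h256 : (256 : ℝ) ≤ Real.exp 255 := by
      have := Real.add_one_le_exp (255 : ℝ); linarith
    have hexpL : Real.exp (-L) ≤ η₀ * q₀ / k := by
      rw [le_div_iff₀ (by linarith)]
      calc Real.exp (-L) * k ≤ Real.exp (-L) * m := by gcongr; exact_mod_cast h.k_le_m
        _ ≤ η₀ * q₀ := by linarith
    rw [e]
    calc 2 * Real.exp (-(1 / η * (1 / 224)))
        ≤ Real.exp 1 * Real.exp (-(1 / η * (1 / 224))) := by gcongr
      _ = Real.exp (1 - 1 / η * (1 / 224)) := by rw [← Real.exp_add]; rfl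
      -- From `1 / η > 1000 L²` and `L ≥ 10` it follows that `1 / (224 η) ≥ L + 256`.
      _ ≤ Real.exp (-L - 255) := Real.exp_le_exp.2 (by nlinarith)
      _ = Real.exp (-L) / Real.exp 255 := by rw [Real.exp_sub]
      _ ≤ η₀ * q₀ / k / 256 := by gcongr
      _ = τ := by rw [hτ, div_div, mul_comm (k : ℝ)]
  have hcount := h.measureReal_count_ge_le hx (E := fun _ => E) (μ := τ * N)
    (fun _ => measurableSet_rest w i _) (by
      calc _ ≤ ∑ r : Fin N, τ := Finset.sum_le_sum fun r _ => hEp r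
        _ = _ := by simp [mul_comm]) (by
      have h1 := h.q₀_mul_N_mul_η₀_ge
      have hℓ := h.log_pos
      have e1 : (k : ℝ) ≤ k ^ 2 * m ^ 2 := by
        have := one_le_pow₀ h.one_le_m_real (n := 2)
        nlinarith
      have e2 : 1 ≤ 1 / η := by rw [le_div_iff₀ hη]; linarith [h.η_lt_one]
      have e3 : η₀ ^ 2 ≤ η₀ := by nlinarith
      rw [hτ, div_mul_eq_mul_div, le_div_iff₀ (by positivity)]
      set ℓ := Real.log (1 / γ)
      calc 12 * ℓ * (256 * k) ≤ 10 ^ 6 * k * (ℓ * 1) := by nlinarith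
        _ ≤ 10 ^ 6 * (k ^ 2 * m ^ 2) * (ℓ * (1 / η)) := by gcongr
        _ = 10 ^ 6 * k ^ 2 * m ^ 2 * (ℓ * (1 / η)) := by ring
        _ ≤ q₀ * N * η₀ ^ 2 := h1
        _ ≤ q₀ * N * η₀ := by gcongr
        _ = η₀ * q₀ * N := by ring)
  have hmean := h.measureReal_not_meanGood_le hx (I := {i}) (i₁ := i) (i₂ := i) (i₃ := i)
    (by simp) (by simp) (b := fun _ => b) (fun _ => hb)
  have hM : q₀ * N ≤ coverCount S {i} :=
    h.coverCount_ge (i₁ := i) (i₂ := i) (i₃ := i) (by simp)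
  have hM0 := hqN.trans_le hM
  refine le_trans (measureReal_mono (fun ω hω => ?_) (measure_ne_top _ _) :
    _ ≤ P.real ({ω | 2 * (τ * N) ≤
        ((Finset.univ.filter fun r => (fun i => x r ω i) ∈ E).card : ℝ)} ∪
      {ω | ¬MeanGood S {i} (fun _ => b) (η₀ / 64) fun r => x r ω}))
    ((measureReal_union_le _ _).trans (by linarith [h.γ_pos]))
  by_contra hcon
  simp only [Set.mem_union, Set.mem_ofPred_eq, not_or, not_le, not_not] at hcon
  obtain ⟨hEc, hgood⟩ := hcon
  refine hω fun v hv => ?_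
  have hX : ∀ r, inner ℝ (synth A (x r ω)) z = ∑ j, x r ω j * w j := fun r => by
    rw [real_inner_comm, inner_synth]
  have hDM : τ * N * k = η₀ / 256 * (q₀ * N) := by rw [hτ]; field_simp
  have hD0 : 0 < τ * N := by positivity
  -- A quarter of `η₀` comes from averaging (`16 * η₀ / 64`) and a quarter from exceptional samples;
  -- the remaining factor two is spent on the normalization.
  have key : ‖halfMean z (fun r => synth A (x r ω)) - b • A i‖ ≤ η₀ / 2 := by
    have h1 := hgood.norm_meanOf_sub_le h.unit h.card_le (fun _ => hb)
      (fun r => 1 / 2 ≤ inner ℝ (synth A (x r ω)) z) hM0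
      (by linarith) h.one_le_m (D := 2 * (τ * N)) (by
        refine le_trans (Nat.cast_le.2 (Finset.card_le_card fun r hr => ?_)) hEc.le
        simp only [Finset.mem_filter, Finset.mem_univ, true_and] at hr ⊢
        by_contra hrE
        refine hr ?_
        rw [hX, half_le_sum_iff (w := w) (hgood.isSignOn r) hb (by linarith) hbw (not_lt.1 hrE)]
        simp [AgreesOn]) (by nlinarith)
    rw [Finset.sum_singleton, Finset.card_singleton] at h1
    have h2 : 16 * (2 * (τ * N)) * ((k : ℝ) + (1 : ℕ)) / coverCount S {i} ≤ η₀ / 4 := by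
      rw [div_le_iff₀ hM0]
      push_cast
      have h3 : τ * N ≤ τ * N * k := by nlinarith
      nlinarith
    rw [halfMean]
    linarith
  have hbA : ‖b • A i‖ = 1 := by
    rw [norm_smul, h.unit, mul_one]; rcases hb with h | h <;> simp [h]
  refine ⟨i, b, by rcases hb with h | h <;> simp [h], ?_, ?_, by linarith⟩
  · exact Real.le_sqrt_of_sq_le (by linarith)
  · rw [(testColRad_eq_some hv).2.2.2]
    exact (norm_normalize_sub_le hbA (by linarith) key).trans (by linarith)

/-- The total probability of bad correlations. -/
lemma not_forall_exists_isBad (h : TestSetting n m k N A S γ η η₀ q₀ κ₀ δ)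
    (hx : IsRademacherOn P S x) {w : Fin m → ℝ}
    (hfew : ∑ r, P.real {ω | (fun i => x r ω i) ∈ {v | IsBad w η v}} < 4 * (κ₀ * N))
    {I : Finset (Fin m)} {i₁ i₂ i₃ : Fin m} (hI : I ⊆ {i₁, i₂, i₃})
    {F : Finset (Finset (Fin m))} (hF : F.card ≤ 8 * m) :
    ¬∀ r, I ⊆ S r → ∀ v, IsSignOn (S r) v → ∃ J ∈ F, IsBad w η (flip J v) := by
  classical
  intro hall
  have := hx.isProbabilityMeasure
  have hM := h.coverCount_ge hI
  have hm := h.m_pos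
  have hbd : ∀ r ∈ Finset.univ.filter (fun r => I ⊆ S r),
      1 / (8 * m) ≤ P.real {ω | (fun i => x r ω i) ∈ {v | IsBad w η v}} := by
    intro r hr
    -- If every sign vector has a bad flip in `F`, being bad has probability at least `1 / #F`.
    -- Summed over the covering samples this gives `q₀ N / (8 m)`, far more than `4 κ₀ N`.
    have key := hx.measureReal_le_card_mul r F Set.univ (measurableSet_isBad w η)
      fun v hv _ => hall r (Finset.mem_filter.1 hr).2 v hv
    simp only [Set.mem_univ, Set.ofPred_true, probReal_univ] at key
    rw [div_le_iff₀ (by positivity), mul_comm]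
    refine key.trans ?_
    have : (F.card : ℝ) ≤ 8 * m := by exact_mod_cast hF
    gcongr
  have h1 : q₀ * N * (1 / (8 * m)) ≤
      ∑ r, P.real {ω | (fun i => x r ω i) ∈ {v | IsBad w η v}} := by
    calc q₀ * N * (1 / (8 * m)) ≤ coverCount S I * (1 / (8 * m)) := by gcongr
      _ = ∑ r ∈ Finset.univ.filter (fun r => I ⊆ S r), 1 / (8 * (m : ℝ)) := by
          rw [Finset.sum_const, nsmul_eq_mul, coverCount]
      _ ≤ _ := Finset.sum_le_sum hbd
      _ ≤ _ := Finset.sum_le_sum_of_subset_of_nonneg (Finset.subset_univ _)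
          fun _ _ _ => measureReal_nonneg
  have h2 := h1.trans_lt hfew
  rw [mul_one_div, div_lt_iff₀ (by positivity)] at h2
  have h3 := mul_le_mul_of_nonneg_right h.κ₀_mul_m_le' h.N_pos.le
  nlinarith [h.q₀_mul_N_pos]

/-- Many bad correlations are detected by the first condition of the test. -/
lemma soundness_of_many_bad (h : TestSetting n m k N A S γ η η₀ q₀ κ₀ δ)
    (hx : IsRademacherOn P S x) {z : Vec n}
    (hmany : 4 * (κ₀ * N) ≤
      ∑ r, P.real {ω | (fun i => x r ω i) ∈ {v | IsBad (fun j => inner ℝ z (A j)) η v}}) :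
    P.real {ω | ¬∀ v, testColRad z (fun r => synth A (x r ω)) (2 * κ₀) (1 / 2 * η * q₀) η ≠
      some v} ≤ γ / 2 := by
  classical
  have := hx.isProbabilityMeasure
  have h1 := h.κ₀_mul_N_ge'
  have hℓ := h.log_pos
  have hcount := measureReal_count_le_half_le hx.iIndepFun_coeff hx.measurable_coeff
    (E := fun _ => {v | IsBad (fun j => inner ℝ z (A j)) η v})
    (fun _ => measurableSet_isBad _ η) Finset.univ (by linarith) hmany
  have h2 : Real.exp (-(4 * (κ₀ * N)) / 8) ≤ γ / 8 := by
    rw [neg_div]; exact h.exp_le_of_log_le (by linarith)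
  refine le_trans (measureReal_mono (fun ω hω => ?_) (measure_ne_top _ _))
    (hcount.trans (by linarith [h.γ_pos]))
  by_contra hcon
  rw [Set.mem_ofPred_eq, not_le] at hcon
  refine hω fun v hv => ?_
  have hc := (testColRad_eq_some hv).1
  rw [fraction_lt_iff h.N_pos] at hc
  refine lt_irrefl _ (hcon.trans (lt_of_le_of_lt (Nat.cast_le.2 (Finset.card_le_card
    fun r hr => ?_)) (hc.trans_eq (by ring))))
  simp only [Finset.mem_filter, Finset.mem_univ, true_and, Set.mem_ofPred_eq] at hr ⊢
  rw [inner_synth]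
  exact hr

/-- The coefficient vectors some path flip of which has a bad correlation. -/
def pathBad (w : Fin m → ℝ) (η : ℝ) (H : Finset (Fin m)) : Set (Fin m → ℝ) :=
  {v | ∃ J ∈ pathFlips H, IsBad w η (flip J v)}

lemma measurableSet_pathBad (w : Fin m → ℝ) (η : ℝ) (H : Finset (Fin m)) :
    MeasurableSet (pathBad w η H) := by
  have : pathBad w η H = ⋃ J ∈ pathFlips H, flip J ⁻¹' {v | IsBad w η v} := by
    ext v; simp [pathBad]
  rw [this]
  exact Finset.measurableSet_biUnion _ fun J _ => measurable_flip J (measurableSet_isBad w η)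

open Classical in
/-- If bad correlations are rare, so are samples with a bad path flip. -/
lemma measureReal_count_pathBad_le (h : TestSetting n m k N A S γ η η₀ q₀ κ₀ δ)
    (hx : IsRademacherOn P S x) {w : Fin m → ℝ}
    (hfew : ∑ r, P.real {ω | (fun i => x r ω i) ∈ {v | IsBad w η v}} < 4 * (κ₀ * N))
    {H : Finset (Fin m)} (hH : H.card ≤ 2) :
    P.real {ω | 2 * (32 * (κ₀ * m) * N) ≤
      ((Finset.univ.filter fun r => (fun i => x r ω i) ∈ pathBad w η H).card : ℝ)} ≤ γ / 8 := by
  refine h.measureReal_count_ge_le hx (E := fun _ => pathBad w η H)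
    (fun _ => measurableSet_pathBad w η H) ?_ ?_
  · have hcard : ((pathFlips H).card : ℝ) ≤ 8 * m := by
      exact_mod_cast card_pathFlips_le hH h.one_le_m
    calc ∑ r, P.real {ω | (fun i => x r ω i) ∈ pathBad w η H}
        ≤ ∑ r, 8 * m * P.real {ω | (fun i => x r ω i) ∈ {v | IsBad w η v}} := by
          refine Finset.sum_le_sum fun r _ => ?_
          refine (hx.measureReal_le_card_mul r (pathFlips H) _ (measurableSet_isBad w η)
            fun v _ hv => hv).trans ?_
          gcongr
      _ = 8 * m * ∑ r, P.real {ω | (fun i => x r ω i) ∈ {v | IsBad w η v}} := by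
          rw [Finset.mul_sum]
      _ ≤ 8 * m * (4 * (κ₀ * N)) := by gcongr
      _ = _ := by ring
  · have h1 := h.κ₀_mul_N_ge'
    have h2 := h.log_pos
    have h3 := h.one_le_m_real
    have h4 : 0 ≤ κ₀ * N := mul_nonneg h.κ₀_pos.le h.N_pos.le
    calc 12 * Real.log (1 / γ) ≤ 1 * (κ₀ * N) := by linarith
      _ ≤ (32 * m) * (κ₀ * N) := by gcongr; linarith
      _ = _ := by ring

/-- If all correlations are small, then few samples pass the second condition. -/
lemma soundness_of_small (h : TestSetting n m k N A S γ η η₀ q₀ κ₀ δ)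
    (hx : IsRademacherOn P S x) {z : Vec n} (hsmall : ∀ j, |inner ℝ z (A j)| ≤ η)
    (hfew : ∑ r, P.real {ω | (fun i => x r ω i) ∈
      {v | IsBad (fun j => inner ℝ z (A j)) η v}} < 4 * (κ₀ * N)) :
    P.real {ω | ¬∀ v, testColRad z (fun r => synth A (x r ω)) (2 * κ₀) (1 / 2 * η * q₀) η ≠
      some v} ≤ γ / 2 := by
  classical
  have := hx.isProbabilityMeasure
  have hη1 := h.η_lt_small
  have hcount := h.measureReal_count_pathBad_le hx hfew (H := ∅) (by simp)
  have hsign : ∀ᵐ ω ∂P, ∀ r, IsSignOn (S r) fun i => x r ω i := ae_all_iff.2 hx.ae_isSignOn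
  refine le_trans (ENNReal.toReal_mono (measure_ne_top _ _) (measure_mono_ae ?_))
    (hcount.trans (by linarith [h.γ_pos]))
  filter_upwards [hsign] with ω hs hω
  by_contra hcon
  have hcon' := not_le.1 hcon
  refine hω fun v hv => ?_
  have hc := (testColRad_eq_some hv).2.1
  rw [le_fraction_iff h.N_pos] at hc
  have hle : ((Finset.univ.filter fun r => |inner ℝ z (synth A (x r ω))| ∈
      Set.Icc (1 - η) (1 + η)).card : ℝ) ≤
      ((Finset.univ.filter fun r => (fun i => x r ω i) ∈
        pathBad (fun j => inner ℝ z (A j)) η ∅).card : ℝ) := by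
    refine Nat.cast_le.2 (Finset.card_le_card fun r hr => ?_)
    simp only [Finset.mem_filter, Finset.mem_univ, true_and] at hr ⊢
    by_contra hrb
    have h1 := abs_sum_le_of_forall_not_isBad h.η_pos (by linarith) (hs r) hsmall
      fun J hJ hJb => hrb ⟨J, hJ, hJb⟩
    rw [inner_synth] at hr
    linarith [hr.1]
  have h3 := mul_le_mul_of_nonneg_right h.κ₀_mul_m_le h.N_pos.le
  have h4 : 0 < η * (q₀ * N) := mul_pos h.η_pos h.q₀_mul_N_pos
  -- The factor `η` in `κ₀` is spent here: the second threshold is itself proportional to `η`.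
  have h5 : 2 * (32 * (κ₀ * m) * N) ≤ 1 / 2 * η * q₀ * N := by nlinarith
  linarith

/-- If two correlations are close to `1/2`, then the mean in the third condition is too long. -/
lemma soundness_of_two_halves (h : TestSetting n m k N A S γ η η₀ q₀ κ₀ δ)
    (hx : IsRademacherOn P S x) {z : Vec n} {i j : Fin m} (hij : i ≠ j)
    (hwi : |2 * |inner ℝ z (A i)| - 1| ≤ 2 * η) (hwj : |2 * |inner ℝ z (A j)| - 1| ≤ 2 * η)
    (hsmall : ∀ l, l ≠ i → l ≠ j → |inner ℝ z (A l)| ≤ η)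
    (hfew : ∑ r, P.real {ω | (fun i => x r ω i) ∈
      {v | IsBad (fun j => inner ℝ z (A j)) η v}} < 4 * (κ₀ * N)) :
    P.real {ω | ¬∀ v, testColRad z (fun r => synth A (x r ω)) (2 * κ₀) (1 / 2 * η * q₀) η ≠
      some v} ≤ γ / 2 := by
  classical
  have := hx.isProbabilityMeasure
  set w : Fin m → ℝ := fun j => inner ℝ z (A j) with hw
  set b : Fin m → ℝ := fun l => signOf (w l) with hbdef
  have hb : ∀ l, b l = 1 ∨ b l = -1 := fun l => signOf_eq _
  have hη := h.η_pos
  have hη1 := h.η_lt_small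
  have hk := h.one_le_k_real
  have hcount := h.measureReal_count_pathBad_le hx hfew (H := {i, j})
    (by rw [Finset.card_pair hij])
  have hmean := h.measureReal_not_meanGood_le hx (I := {i, j}) (i₁ := i) (i₂ := j) (i₃ := j)
    (by rw [Finset.card_pair hij]) (by simp) hb
  have hM : q₀ * N ≤ coverCount S {i, j} :=
    h.coverCount_ge (i₁ := i) (i₂ := j) (i₃ := j) (by simp)
  have hM0 := h.q₀_mul_N_pos.trans_le hM
  refine le_trans (measureReal_mono (fun ω hω => ?_) (measure_ne_top _ _))
    ((measureReal_union_le _ _).trans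
      ((add_le_add hcount hmean).trans (by linarith [h.γ_pos])))
  by_contra hcon
  simp only [Set.mem_union, Set.mem_ofPred_eq, not_or, not_le, not_not] at hcon
  obtain ⟨hEc, hgood⟩ := hcon
  refine hω fun v hv => ?_
  have hc := (testColRad_eq_some hv).2.2.1
  have hX : ∀ r, inner ℝ (synth A (x r ω)) z = ∑ j, x r ω j * w j := fun r => by
    rw [real_inner_comm, inner_synth]
  have h7 : κ₀ * (k * m) * N ≤ 1 / 10 ^ 9 * (q₀ * N) := by
    have := mul_le_mul_of_nonneg_right h.κ₀_mul_le' h.N_pos.le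
    linarith
  have h9 : 0 ≤ κ₀ * m * N :=
    mul_nonneg (mul_nonneg h.κ₀_pos.le h.m_pos.le) h.N_pos.le
  have h8 : κ₀ * m * N ≤ 1 / 10 ^ 9 * (q₀ * N) := by
    refine le_trans ?_ h7
    calc κ₀ * m * N = 1 * (κ₀ * m * N) := by ring
      _ ≤ k * (κ₀ * m * N) := by gcongr
      _ = _ := by ring
  have key := hgood.norm_meanOf_sub_le h.unit h.card_le hb
    (fun r => inner ℝ (synth A (x r ω)) z ∈ Set.Ioo (1 - 10 * η) (1 + 10 * η)) hM0
    (by linarith [h.η₀_pos]) h.one_le_m (D := 2 * (32 * (κ₀ * m) * N)) (by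
      refine le_trans (Nat.cast_le.2 (Finset.card_le_card fun r hr => ?_)) hEc.le
      simp only [Finset.mem_filter, Finset.mem_univ, true_and] at hr ⊢
      by_contra hrb
      refine hr ?_
      rw [hX]
      exact mem_Ioo_iff_of_forall_not_isBad hη (by linarith) (hgood.isSignOn r) hij hsmall hwi hwj
        hb (fun l => signOf_mul _) fun J hJ hJb => hrb ⟨J, hJ, hJb⟩) (by
      linarith [h.q₀_mul_N_pos])
  rw [Finset.sum_pair hij, Finset.card_pair hij] at key
  -- The factor `k` in the denominator of `κ₀` is spent here, as each exceptional sample may be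
  -- displaced by `k + 2`.
  have h2 : 16 * (2 * (32 * (κ₀ * m) * N)) * ((k : ℝ) + (2 : ℕ)) / coverCount S {i, j} ≤
      1 / 100 := by
    rw [div_le_iff₀ hM0]
    push_cast
    have e : 16 * (2 * (32 * (κ₀ * m) * N)) * ((k : ℝ) + 2) =
      1024 * (κ₀ * (k * m) * N) + 2048 * (κ₀ * m * N) := by ring
    rw [e]
    linarith [h.q₀_mul_N_pos]
  have hinner : inner ℝ (A i) (A j) ^ 2 ≤ 1 / 100 := by
    have h3 := h.rip.sum_inner_column_sq_le h.δ_nonneg (by linarith [h.δ_le_tenth]) h.unit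
      h.two_le_k (T := {j}) (i := i) (by simpa using h.one_le_k) (by simpa using hij)
    rw [Finset.sum_singleton] at h3
    linarith [h.δ_le_η]
  -- Two unit vectors with inner product at most `1/10` in absolute value. The test would bound
  -- their signed sum by `1.1` plus errors, hence by `1.2`, but `1.2² < 3/2`.
  have hlong : (3 / 2 : ℝ) ≤ ‖b i • A i + b j • A j‖ ^ 2 := by
    rw [norm_add_sq_real, norm_smul, norm_smul, h.unit, h.unit, real_inner_smul_left,
      real_inner_smul_right]
    have h4 := abs_le.1 (abs_le_of_sq_le_sq (a := inner ℝ (A i) (A j)) (b := 1 / 10)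
      (by linarith) (by norm_num))
    rcases hb i with h5 | h5 <;> rcases hb j with h6 | h6 <;> rw [h5, h6] <;> norm_num <;>
      linarith [h4.1, h4.2]
  have h5 := norm_le_norm_add_norm_sub' (b i • A i + b j • A j)
    (meanOf (fun r => synth A (x r ω)) (fun r =>
      inner ℝ (synth A (x r ω)) z ∈ Set.Ioo (1 - 10 * η) (1 + 10 * η)))
  rw [norm_sub_rev] at h5
  have h6 : ‖b i • A i + b j • A j‖ ≤ 12 / 10 := by linarith [h.η₀_lt]
  nlinarith [norm_nonneg (b i • A i + b j • A j)]

theorem soundness (h : TestSetting n m k N A S γ η η₀ q₀ κ₀ δ)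
    (hx : IsRademacherOn P S x) {z : Vec n} (hz : ‖z‖ = 1) :
    P.real {ω | ¬∀ v, testColRad z (fun r => synth A (x r ω)) (2 * κ₀) (1 / 2 * η * q₀) η =
      some v → ∃ i, ∃ b ∈ ({-1, 1} : Set ℝ), ‖z - b • A i‖ ≤ √(8 * η) ∧ ‖v - b • A i‖ ≤ η₀ ∧
        ‖halfMean z (fun r => synth A (x r ω)) - b • A i‖ ≤ η₀} ≤ γ / 2 := by
  classical
  have := hx.isProbabilityMeasure
  have hη := h.η_pos
  have hη1 := h.η_lt_small
  by_cases hone : ∃ i, 1 - η ≤ |inner ℝ z (A i)|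
  · obtain ⟨i, hi⟩ := hone
    exact h.soundness_of_correlated hx hz hi
  push Not at hone
  suffices P.real {ω | ¬∀ v, testColRad z (fun r => synth A (x r ω)) (2 * κ₀)
      (1 / 2 * η * q₀) η ≠ some v} ≤ γ / 2 by
    refine le_trans (measureReal_mono (fun ω hω => ?_) (measure_ne_top _ _)) this
    exact fun hω' => hω fun v hv => absurd hv (hω' v)
  by_cases hmany : 4 * (κ₀ * N) ≤
      ∑ r, P.real {ω | (fun i => x r ω i) ∈ {v | IsBad (fun j => inner ℝ z (A j)) η v}}
  · exact h.soundness_of_many_bad hx hmany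
  rw [not_le] at hmany
  -- Not all sign vectors become bad under `∅` or `{i}`; one that stays good under both locates `|w
  -- i|`.
  have hclass : ∀ i, |inner ℝ z (A i)| ≤ η ∨ |2 * |inner ℝ z (A i)| - 1| ≤ 2 * η := by
    intro i
    have h1 := h.not_forall_exists_isBad hx hmany (I := {i}) (i₁ := i) (i₂ := i) (i₃ := i)
      (by simp) (F := {∅, {i}})
      ((Finset.card_le_two).trans (by have := h.one_le_m; omega))
    push Not at h1
    obtain ⟨r, hir, v, hv, hgood⟩ := h1
    have h2 := abs_cases_of_not_isBad (by linarith) hv (Finset.singleton_subset_iff.1 hir)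
      (by simpa [flip_empty] using hgood ∅ (by simp)) (hgood {i} (by simp))
    rcases h2 with h2 | h2 | h2
    · exact Or.inl h2
    · exact Or.inr h2
    · exact absurd h2 (not_le.2 (hone i))
  by_cases hsmall : ∀ i, |inner ℝ z (A i)| ≤ η
  · exact h.soundness_of_small hx hsmall hmany
  push Not at hsmall
  obtain ⟨i, hi⟩ := hsmall
  have hwi := (hclass i).resolve_left (not_le.2 hi)
  by_cases hsmall : ∀ j, j ≠ i → |inner ℝ z (A j)| ≤ η
  · exfalso
    refine h.not_forall_exists_isBad hx hmany (I := {i}) (i₁ := i) (i₂ := i) (i₃ := i)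
      (by simp) (F := pathFlips {i}) (card_pathFlips_le (by simp) h.one_le_m) ?_
    intro r hir v hv
    exact exists_isBad_of_mem hη (by linarith) hv hsmall (Finset.singleton_subset_iff.1 hir) hwi
  push Not at hsmall
  obtain ⟨j, hji, hj⟩ := hsmall
  have hwj := (hclass j).resolve_left (not_le.2 hj)
  by_cases hsmall : ∀ l, l ≠ i → l ≠ j → |inner ℝ z (A l)| ≤ η
  · exact h.soundness_of_two_halves hx hji.symm hwi hwj hsmall hmany
  push Not at hsmall
  obtain ⟨l, hli, hlj, hl⟩ := hsmall
  have hwl := (hclass l).resolve_left (not_le.2 hl)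
  exfalso
  refine h.not_forall_exists_isBad hx hmany (I := {i, j, l}) (Finset.Subset.refl _)
    (F := ({i, j, l} : Finset (Fin m)).powerset) ?_ ?_
  · rw [Finset.card_powerset]
    have h1 : ({i, j, l} : Finset (Fin m)).card ≤ 3 := Finset.card_le_three
    have h2 := Nat.pow_le_pow_right (n := 2) (by norm_num) h1
    have := h.one_le_m
    omega
  · intro r hr v hv
    -- Three aligned halves give at least `3/2 - 3 η`, beyond `1 + η`, whatever the other
    -- coordinates do.
    obtain ⟨K, hK, hsum⟩ := exists_flip_abs_sum_ge hv hr fun j => inner ℝ z (A j)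
    refine ⟨K, Finset.mem_powerset.2 hK, ?_⟩
    rw [Finset.sum_insert (by simp [hji.symm, hli.symm]), Finset.sum_pair hlj.symm] at hsum
    have e1 := (abs_le.1 hwi).1
    have e2 := (abs_le.1 hwj).1
    have e3 := (abs_le.1 hwl).1
    rw [isBad_iff]
    exact ⟨fun hh => by linarith [hh.2], fun hh => by linarith⟩

end TestSetting


/-! ### A linear-time program for the test -/

/-- The constants that the test compares with. -/
def testSetup : Prog :=
  .seq (.op (.const 4 1)) <| .seq (.op (.const 15 (1 / 2))) <| .seq (.op (.const 12 (1 / 32))) <|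
  .seq (.op (.const 13 10)) <| .seq (.op (.sub 10 4 3)) <| .seq (.op (.add 11 4 3)) <|
  .seq (.op (.mul 12 12 3)) <| .seq (.op (.mul 14 13 3)) <| .seq (.op (.sub 13 4 14)) <|
  .op (.add 14 4 14)

/-- Update the two counters of the first two conditions. -/
def countStep : Prog :=
  -- The lower end `0` of the central window needs no comparison, as register `17` holds an absolute
  -- value.
  .ite 10 17 (.ite 17 11 (.op (.add 6 6 4)) (.ite 17 12 .skip (.op (.add 7 7 4))))
    (.ite 17 12 .skip (.op (.add 7 7 4)))

/-- Update the sum over the window of the third condition. -/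
def windowStep : Prog :=
  -- The window is open, so ties are skipped.
  .ite 16 13 .skip (.ite 14 16 .skip (.seq (.op (.add 8 8 4)) (.op (.vadd 2 2 0))))

/-- Update the sum whose mean is the answer. -/
def halfStep : Prog :=
  .ite 15 16 (.seq (.op (.add 9 9 4)) (.op (.vadd 3 3 0))) .skip

/-- Update the counters and the two vector sums with the current sample. -/
def testStep : Prog :=
  .seq (.op (.inner 16 1 0)) <| .seq (.op (.abs 17 16)) <| .seq (.op (.add 5 5 4)) <|
  .seq countStep <| .seq windowStep halfStep

/-- Evaluate the three conditions and produce the answer. -/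
def testFinish : Prog :=
  -- Division by zero returns `0`, so an empty selection gets mean `0`, in accordance with `meanOf`.
  .seq (.op (.div 18 7 5)) <| .seq (.op (.div 19 6 5)) <| .seq (.op (.div 20 4 8)) <|
  .seq (.op (.smul 4 20 2)) <| .seq (.op (.norm 21 4)) <| .seq (.op (.const 22 (11 / 10))) <|
  -- The first condition is strict, so equality leads to NO, which is the default: register `0`
  -- still holds `0`.
  .ite 1 18 .skip <| .ite 2 19 (.ite 21 22
    (.seq (.op (.div 23 4 9)) <| .seq (.op (.smul 5 23 3)) <| .seq (.op (.norm 24 5)) <|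
      .seq (.op (.div 25 4 24)) <| .seq (.op (.smul 0 25 5)) <| .op (.const 0 1)) .skip) .skip

/-- The program for `testColRad`. -/
def testProg : Prog := .seq testSetup (.seq (.forEach testStep) testFinish)

open Classical in
/-- The registers after the samples in the list `l` have been processed. -/
structure TestInvariant {n N : ℕ} (z : Vec n) (Y : Fin N → Vec n) (κ₀ κ₁ η : ℝ)
    (l : List (Fin N)) (s : Mem n) : Prop where
  num_zero : s.num 0 = 0
  num_one : s.num 1 = κ₀
  num_two : s.num 2 = κ₁
  num_four : s.num 4 = 1
  lower : s.num 10 = 1 - η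
  upper : s.num 11 = 1 + η
  center : s.num 12 = η / 32
  windowLower : s.num 13 = 1 - 10 * η
  windowUpper : s.num 14 = 1 + 10 * η
  half : s.num 15 = 1 / 2
  query : s.vec 1 = z
  total : s.num 5 = l.length
  countOne : s.num 6 = (l.map fun r =>
    if |inner ℝ z (Y r)| ∈ Set.Icc (1 - η) (1 + η) then (1 : ℝ) else 0).sum
  countBad : s.num 7 = (l.map fun r =>
    if |inner ℝ z (Y r)| ∉ Set.Icc (1 - η) (1 + η) ∪ Set.Icc 0 (η / 32)
      then (1 : ℝ) else 0).sum
  countWindow : s.num 8 = (l.map fun r =>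
    if inner ℝ (Y r) z ∈ Set.Ioo (1 - 10 * η) (1 + 10 * η) then (1 : ℝ) else 0).sum
  countHalf : s.num 9 = (l.map fun r => if 1 / 2 ≤ inner ℝ (Y r) z then (1 : ℝ) else 0).sum
  sumWindow : s.vec 2 = (l.map fun r =>
    if inner ℝ (Y r) z ∈ Set.Ioo (1 - 10 * η) (1 + 10 * η) then Y r else 0).sum
  sumHalf : s.vec 3 = (l.map fun r => if 1 / 2 ≤ inner ℝ (Y r) z then Y r else 0).sum

section Run

variable {n N : ℕ} (z : Vec n) (Y : Fin N → Vec n) (κ₀ κ₁ η : ℝ)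

lemma testSetup_run :
    TestInvariant z Y κ₀ κ₁ η [] (testSetup.run Y (Mem.input z κ₀ κ₁ η)).1 ∧
      (testSetup.run Y (Mem.input z κ₀ κ₁ η)).2 = 10 := by
  refine ⟨?_, by simp [testSetup, Prog.run]⟩
  constructor <;> simp [testSetup, Prog.run, Instr.exec, Mem.input]
  ring

variable {z Y κ₀ κ₁ η}

open Classical in
lemma countStep_run {s : Mem n} (h4 : s.num 4 = 1) :
    (countStep.run Y s).1 =
      ⟨Function.update (Function.update s.num
          6 (s.num 6 + if s.num 10 ≤ s.num 17 ∧ s.num 17 ≤ s.num 11 then 1 else 0))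
          7 (s.num 7 + if ¬(s.num 10 ≤ s.num 17 ∧ s.num 17 ≤ s.num 11) ∧ ¬s.num 17 ≤ s.num 12
            then 1 else 0), s.vec⟩ ∧
      (countStep.run Y s).2 ≤ 4 := by
  by_cases c1 : s.num 10 ≤ s.num 17 <;> by_cases c2 : s.num 17 ≤ s.num 11 <;>
  by_cases c3 : s.num 17 ≤ s.num 12 <;>
  simp [countStep, Prog.run, Instr.exec, c1, c2, c3, h4]

open Classical in
lemma windowStep_run {s : Mem n} (h4 : s.num 4 = 1) :
    (windowStep.run Y s).1 =
      ⟨Function.update s.num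
          8 (s.num 8 + if ¬s.num 16 ≤ s.num 13 ∧ ¬s.num 14 ≤ s.num 16 then 1 else 0),
        Function.update s.vec
          2 (s.vec 2 + if ¬s.num 16 ≤ s.num 13 ∧ ¬s.num 14 ≤ s.num 16 then s.vec 0 else 0)⟩ ∧
      (windowStep.run Y s).2 ≤ 4 := by
  by_cases c1 : s.num 16 ≤ s.num 13 <;> by_cases c2 : s.num 14 ≤ s.num 16 <;>
  simp [windowStep, Prog.run, Instr.exec, c1, c2, h4]

open Classical in
lemma halfStep_run {s : Mem n} (h4 : s.num 4 = 1) :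
    (halfStep.run Y s).1 =
      ⟨Function.update s.num 9 (s.num 9 + if s.num 15 ≤ s.num 16 then 1 else 0),
        Function.update s.vec 3 (s.vec 3 + if s.num 15 ≤ s.num 16 then s.vec 0 else 0)⟩ ∧
      (halfStep.run Y s).2 ≤ 3 := by
  by_cases c1 : s.num 15 ≤ s.num 16 <;> simp [halfStep, Prog.run, Instr.exec, c1, h4]

lemma testStep_run {l : List (Fin N)} {s : Mem n} (hs : TestInvariant z Y κ₀ κ₁ η l s)
    (r : Fin N) :
    TestInvariant z Y κ₀ κ₁ η (l ++ [r])
        (testStep.run Y { s with vec := Function.update s.vec 0 (Y r) }).1 ∧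
      (testStep.run Y { s with vec := Function.update s.vec 0 (Y r) }).2 ≤ 14 := by
  obtain ⟨h0, h1, h2, h4, h10, h11, h12, h13, h14, h15, hz, h5, h6, h7, h8, h9, hv2, hv3⟩ := hs
  have hcomm : inner ℝ z (Y r) = inner ℝ (Y r) z := real_inner_comm _ _
  set u : Mem n := ⟨Function.update (Function.update (Function.update s.num 16
    (inner ℝ (s.vec 1) (Y r))) 17 |inner ℝ (s.vec 1) (Y r)|) 5 (s.num 5 + s.num 4),
    Function.update s.vec 0 (Y r)⟩ with hu
  have hrun : testStep.run Y { s with vec := Function.update s.vec 0 (Y r) } =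
      ((halfStep.run Y (windowStep.run Y (countStep.run Y u).1).1).1,
        3 + ((countStep.run Y u).2 + ((windowStep.run Y (countStep.run Y u).1).2 +
          (halfStep.run Y (windowStep.run Y (countStep.run Y u).1).1).2))) := by
    simp [testStep, Prog.run, Instr.exec, u]
    ring
  have hA := countStep_run (Y := Y) (s := u) (by simp [u, h4])
  have hB := windowStep_run (Y := Y) (s := (countStep.run Y u).1) (by rw [hA.1]; simp [u, h4])
  have hC := halfStep_run (Y := Y) (s := (windowStep.run Y (countStep.run Y u).1).1)
    (by rw [hB.1, hA.1]; simp [u, h4])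
  rw [hrun]
  refine ⟨?_, by dsimp only; omega⟩
  dsimp only
  rw [hC.1, hB.1, hA.1, hu]
  constructor <;> simp only [List.map_append, List.map_cons, List.map_nil, List.sum_append,
    List.sum_cons, List.sum_nil, add_zero, List.length_append, List.length_cons, List.length_nil,
    zero_add, Nat.cast_add, Nat.cast_one, hcomm,
    ← h5, ← h6, ← h7, ← h8, ← h9, ← hv2, ← hv3] <;>
    simp [h0, h1, h2, h4, h10, h11, h12, h13, h14, h15, hz, hcomm]

lemma forEach_testStep_run {s : Mem n} (hs : TestInvariant z Y κ₀ κ₁ η [] s) :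
    TestInvariant z Y κ₀ κ₁ η (List.finRange N) ((Prog.forEach testStep).run Y s).1 ∧
      ((Prog.forEach testStep).run Y s).2 ≤ 15 * N := by
  have key : ∀ l : List (Fin N),
      let f := l.foldl (fun t r =>
          let u := testStep.run Y { t.1 with vec := Function.update t.1.vec 0 (Y r) }
          (u.1, t.2 + u.2 + 1)) (s, 0)
      TestInvariant z Y κ₀ κ₁ η l f.1 ∧ f.2 ≤ 15 * l.length := by
    intro l
    -- A left fold processes the last element last, so the list grows at its right end.
    induction l using List.reverseRecOn with
    | nil => exact ⟨hs, le_rfl⟩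
    | append_singleton l r ih =>
      have h := testStep_run ih.1 r
      have h2 := ih.2
      simp only [List.foldl_append, List.foldl_cons, List.foldl_nil, List.length_append,
        List.length_cons, List.length_nil] at h h2 ⊢
      exact ⟨h.1, by omega⟩
  have h := key (List.finRange N)
  rw [List.length_finRange] at h
  simpa only [Prog.run] using h

lemma testFinish_run {s : Mem n} (hs : TestInvariant z Y κ₀ κ₁ η (List.finRange N) s) :
    (testFinish.run Y s).1.output = testColRad z Y κ₀ κ₁ η ∧ (testFinish.run Y s).2 ≤ 15 := by
  classical
  obtain ⟨h0, h1, h2, h4, -, -, -, -, -, -, -, h5, h6, h7, h8, h9, hv2, hv3⟩ := hs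
  have hnum : ∀ (p : Fin N → Prop) [DecidablePred p], ((List.finRange N).map fun r => if p r then (1 : ℝ) else 0).sum
      = ((Finset.univ.filter p).card : ℝ) := fun p _ => by
    rw [← Fin.sum_univ_def, Finset.card_filter]; push_cast; rfl
  have hvec : ∀ (p : Fin N → Prop) [DecidablePred p], ((List.finRange N).map fun r => if p r then Y r else 0).sum
      = ∑ r ∈ Finset.univ.filter p, Y r := fun p _ => by
    rw [← Fin.sum_univ_def, Finset.sum_filter]
  rw [List.length_finRange] at h5
  rw [hnum] at h6 h7 h8 h9
  rw [hvec] at hv2 hv3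
  have e0 : fraction (fun r => |inner ℝ z (Y r)| ∉
      Set.Icc (1 - η) (1 + η) ∪ Set.Icc 0 (η / 32)) = s.num 7 / s.num 5 := by
    rw [h7, h5, fraction]; congr
  have e1 : fraction (fun r => |inner ℝ z (Y r)| ∈ Set.Icc (1 - η) (1 + η))
      = s.num 6 / s.num 5 := by
    rw [h6, h5, fraction]; congr
  have e2 : meanOf Y (fun r => inner ℝ (Y r) z ∈ Set.Ioo (1 - 10 * η) (1 + 10 * η))
      = (s.num 8)⁻¹ • s.vec 2 := by
    rw [h8, hv2, meanOf]; congr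
  have e3 : halfMean z Y = (s.num 9)⁻¹ • s.vec 3 := by
    rw [h9, hv3, halfMean, meanOf]
  have hconst : (1.1 : ℝ) = 11 / 10 := by norm_num
  rw [testColRad, e0, e1, e2, e3, hconst, ← h1, ← h2]
  generalize hq0 : s.num 7 / s.num 5 = q0
  generalize hq1 : s.num 6 / s.num 5 = q1
  by_cases c1 : s.num 1 ≤ q0
  · have : ¬ q0 < s.num 1 := not_lt.2 c1
    simp [testFinish, Prog.run, Instr.exec, Mem.output, hq0, hq1, c1, h0, h4, this]
  · have c1' : q0 < s.num 1 := not_le.1 c1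
    by_cases c2 : s.num 2 ≤ q1
    · by_cases c3 : ‖(s.num 8)⁻¹ • s.vec 2‖ ≤ 11 / 10
      · simp [testFinish, Prog.run, Instr.exec, Mem.output, hq0, hq1, c1, c1', c2, c3, h4]
      · simp [testFinish, Prog.run, Instr.exec, Mem.output, hq0, hq1, c1, c1', c2, c3, h0, h4]
    · simp [testFinish, Prog.run, Instr.exec, Mem.output, hq0, hq1, c1, c1', c2, h0, h4]

/-- The program computes the test in linear time. -/
lemma testProg_run (hN : 1 ≤ N) :
    (testProg.run Y (Mem.input z κ₀ κ₁ η)).1.output = testColRad z Y κ₀ κ₁ η ∧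
      (testProg.run Y (Mem.input z κ₀ κ₁ η)).2 ≤ 40 * N := by
  have h1 := testSetup_run z Y κ₀ κ₁ η
  have h2 := forEach_testStep_run h1.1
  have h3 := testFinish_run h2.1
  have hcost : (testProg.run Y (Mem.input z κ₀ κ₁ η)).2 = _ + (_ + _) := rfl
  -- `10 + (15 N + 15) ≤ 40 N` because `1 ≤ N`.
  exact ⟨h3.1, by rw [hcost]; omega⟩

end Run

end DictTest

/-! ### Assembly of the theorem -/

/-- A union bound for the failure of two properties. -/
lemma DictTest.one_sub_le_measureReal_and {Ω : Type*} [MeasurableSpace Ω] {P : Measure Ω}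
    [IsProbabilityMeasure P] {p q : Ω → Prop} {γ : ℝ} (hp : P.real {ω | ¬p ω} ≤ γ / 2)
    (hq : P.real {ω | ¬q ω} ≤ γ / 2) : 1 - γ ≤ P.real {ω | p ω ∧ q ω} := by
  -- The event and the two failures cover the space; subadditivity needs no measurability.
  have hcover : (1 : ℝ) ≤ P.real {ω | p ω ∧ q ω} +
      (P.real {ω | ¬p ω} + P.real {ω | ¬q ω}) := by
    rw [← probReal_univ (μ := P)]
    refine le_trans (measureReal_mono (fun ω _ => ?_) (measure_ne_top _ _))
      ((measureReal_union_le {ω | p ω ∧ q ω} ({ω | ¬p ω} ∪ {ω | ¬q ω})).trans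
        (add_le_add le_rfl (measureReal_union_le _ _)))
    by_cases h1 : p ω <;> by_cases h2 : q ω <;> simp [h1, h2]
  linarith

theorem theorem4p1 :
    -- running time: one program computes the test on all inputs in `O(N)` steps
    (∃ (p : Prog) (C : ℕ), ∀ (n N : ℕ) (z : Vec n) (Y : Fin N → Vec n) (κ₀ κ₁ η : ℝ), 1 ≤ N →
      (p.run Y (Mem.input z κ₀ κ₁ η)).1.output = testColRad z Y κ₀ κ₁ η ∧
      (p.run Y (Mem.input z κ₀ κ₁ η)).2 ≤ C * N) ∧
    -- completeness and soundness
    ∃ c₁ > (0 : ℝ), ∃ c₂ > (0 : ℝ), ∃ c₃ > (0 : ℝ), ∃ c₄ > (0 : ℝ), ∃ c₅ > (0 : ℝ),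
      ∀ (n m k N : ℕ) (A : Fin m → Vec n) (S : Fin N → Finset (Fin m))
        (γ η η₀ q₀ κ₀ δ : ℝ),
        1 ≤ m → 1 ≤ k →
        0 < γ → γ ≤ 1 / 2 →
        0 < η₀ → η₀ < η → η < 1 →
        0 < q₀ →
        √(c₃ * k / m) < η →
        η < c₁ / Real.log (m * n / (q₀ * η₀)) ^ 2 →
        κ₀ = c₄ * η * q₀ / (k * m) →
        c₂ * k * n * m * Real.log (1 / γ) / (η₀ ^ 3 * κ₀) ≤ N →
        (∀ i, ‖A i‖ = 1) →
        IsRIP A k δ →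
        δ < (η / (16 * Real.log (1 / κ₀))) ^ 2 →
        (∀ r, (S r).card ≤ k) →
        (∀ i₁ i₂ i₃ : Fin m,
          q₀ * N ≤ ({r | i₁ ∈ S r ∧ i₂ ∈ S r ∧ i₃ ∈ S r} : Finset (Fin N)).card) →
        ∀ z : Vec n, ‖z‖ = 1 →
        ∀ (Ω : Type*) [MeasurableSpace Ω] (P : Measure Ω) [IsProbabilityMeasure P]
          (x : Fin N → Ω → Vec m), IsRademacherOn P S x →
          1 - γ ≤ P.real {ω |
            let Y : Fin N → Vec n := fun r => synth A (x r ω)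
            let result := testColRad z Y (2 * κ₀) (c₅ * η * q₀) η
            ((∃ i, ∃ b ∈ ({-1, 1} : Set ℝ),
                ‖z - b • A i‖ ≤ η / (8 * Real.log (1 / κ₀))) →
              ∃ v, result = some v) ∧
            (∀ v, result = some v →
              ∃ i, ∃ b ∈ ({-1, 1} : Set ℝ),
                ‖z - b • A i‖ ≤ √(8 * η) ∧
                ‖v - b • A i‖ ≤ η₀ ∧ ‖halfMean z Y - b • A i‖ ≤ η₀)} := by
  refine ⟨⟨testProg, 40, fun n N z Y κ₀ κ₁ η hN => testProg_run hN⟩, 1 / 1000, by norm_num,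
    10 ^ 6, by norm_num, Real.exp 10, Real.exp_pos _, Real.exp (-1000), Real.exp_pos _, 1 / 2,
    by norm_num, ?_⟩
  intro n m k N A S γ η η₀ q₀ κ₀ δ h1 h2 h3 h4 h5 h6 h7 h8 h9 h10 h11 h12 h13 h14 h15 h16 h17
    z hz Ω _ P _ x hx
  have h : TestSetting n m k N A S γ η η₀ q₀ κ₀ δ :=
    ⟨h1, h2, h3, h4, h5, h6, h7, h8, h9, h10, h11, h12, h13, h14, h15, h16, h17⟩
  dsimp only
  have hsound := h.soundness hx hz
  have hcomp : P.real {ω | ¬((∃ i, ∃ b ∈ ({-1, 1} : Set ℝ),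
      ‖z - b • A i‖ ≤ η / (8 * Real.log (1 / κ₀))) →
      ∃ v, testColRad z (fun r => synth A (x r ω)) (2 * κ₀) (1 / 2 * η * q₀) η = some v)} ≤
      γ / 2 := by
    -- Nearness to a column does not depend on `ω`, so the implication is either vacuous or its
    -- conclusion is needed outright.
    by_cases hnear : ∃ i, ∃ b ∈ ({-1, 1} : Set ℝ), ‖z - b • A i‖ ≤ η / (8 * Real.log (1 / κ₀))
    · obtain ⟨i, b, hb, hi⟩ := hnear
      refine le_trans (measureReal_mono (fun ω hω => ?_) (measure_ne_top _ _))
        (h.completeness hx hz (i := i) (b := b) ?_ hi)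
      · exact fun hyes => hω fun _ => hyes
      · rcases hb with hb | hb
        exacts [Or.inr hb, Or.inl hb]
    · have : {ω | ¬((∃ i, ∃ b ∈ ({-1, 1} : Set ℝ),
          ‖z - b • A i‖ ≤ η / (8 * Real.log (1 / κ₀))) →
          ∃ v, testColRad z (fun r => synth A (x r ω)) (2 * κ₀) (1 / 2 * η * q₀) η = some v)}
          = ∅ := Set.eq_empty_of_forall_notMem fun ω hω => hω fun hn => absurd hn hnear
      rw [this, measureReal_empty]
      linarith
  exact one_sub_le_measureReal_and hcomp hsound
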